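/- A weighted graph $G$ is a finite nonempty node set $V(G)$ with a weight $\alpha_i(G)>0$ for every node $i$ and a weight $\beta_{ij}(G)=\beta_{ji}(G)\in\mathbb R$ for every edge $ij$ (loops $i=j$ allowed), where $\beta_{ij}(G)=0$ if $ij$ is not an edge; put $\alpha_G=\sum_i\alpha_i(G)$. For a finite simple graph $F$ (no loops or multiple edges) let $$t(F,G)=\frac{1}{\alpha_G^{|V(F)|}}\sum_{\phi:V(F)\to V(G)}\ \prod_{i\in V(F)}\alpha_{\phi(i)}(G)\prod_{ij\in E(F)}\beta_{\phi(i)\phi(j)}(G).$$ For weighted graphs $G,G'$ with $\alpha_G=\alpha_{G'}=1$, a fractional overlay is a nonnegative matrix $X=(X_{iu})_{i\in V(G),\,u\in V(G')}$ with $\sum_u X_{iu}=\alpha_i(G)$ for all $i$ and $\sum_i X_{iu}=\alpha_u(G')$ for all $u$, and the cut distance is $$\delta_\square(G,G')=\min_X\ \max_{S,T\subseteq V(G)\times V(G')}\Bigl|\sum_{(i,u)\in S}\ \sum_{(j,v)\in T}X_{iu}X_{jv}\bigl(\beta_{ij}(G)-\beta_{uv}(G')\bigr)\Bigr|,$$ where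 $X$ runs over all fractional overlays of $G$ and $G'$. For general $G,G'$, $\delta_\square(G,G')$ is defined by the same formula after dividing the nodeweights of $G$ by $\alpha_G$ and those of $G'$ by $\alpha_{G'}$. **Theorem 2.5.** Let $(G_n)$ be a sequence of weighted graphs with uniformly bounded edgeweights, i.e. there is a constant $C$ with $|\beta_{ij}(G_n)|\le C$ for all $n$ and all $i,j\in V(G_n)$. Then $(G_n)$ is left-convergent, i.e. $t(F,G_n)$ converges as $n\to\infty$ for every finite simple graph $F$, if and only if $(G_n)$ is a Cauchy sequence in $\delta_\square$, i.e. for every $\varepsilon>0$ there is an $N$ such that $\delta_\square(G_m,G_n)<\varepsilon$ for all $m,n\ge N$. -/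

import Mathlib

open Filter Topology

universe u v

noncomputable section

/-- A (finite, nonempty) weighted graph: every node has a positive weight, and every edge
(including possible loops) has a real weight. As usual, `edgeWeight i j = 0` if `ij` is not an
edge. -/
structure WeightedGraph where
  V : Type u
  [fintypeV : Fintype V]
  [nonemptyV : Nonempty V]
  nodeWeight : V → ℝ
  edgeWeight : V → V → ℝ
  nodeWeight_pos : ∀ i, 0 < nodeWeight i
  edgeWeight_symm : ∀ i j, edgeWeight i j = edgeWeight j i

namespace WeightedGraph

attribute [instance] WeightedGraph.fintypeV WeightedGraph.nonemptyV

/-- The total nodeweight `α_G`. -/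
def totalWeight (G : WeightedGraph.{u}) : ℝ := ∑ i, G.nodeWeight i

theorem totalWeight_pos (G : WeightedGraph.{u}) : 0 < G.totalWeight :=
  Finset.sum_pos (fun i _ => G.nodeWeight_pos i) Finset.univ_nonempty

/-- The weight of an unordered pair of nodes. -/
def pairWeight (G : WeightedGraph.{u}) : Sym2 G.V → ℝ :=
  Sym2.lift ⟨G.edgeWeight, G.edgeWeight_symm⟩

open Classical in
/-- The weighted homomorphism number
`hom(F,G) = ∑_{φ : V(F) → V(G)} ∏_{i ∈ V(F)} α_{φ(i)} ∏_{ij ∈ E(F)} β_{φ(i)φ(j)}`. -/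
def hom {U : Type v} [Fintype U] (F : SimpleGraph U) (G : WeightedGraph.{u}) : ℝ :=
  ∑ φ : U → G.V, (∏ i, G.nodeWeight (φ i)) * ∏ e ∈ F.edgeFinset, G.pairWeight (e.map φ)

/-- The homomorphism density `t(F,G) = hom(F,G) / α_G ^ |V(F)|`. -/
def homDensity {U : Type v} [Fintype U] (F : SimpleGraph U) (G : WeightedGraph.{u}) : ℝ :=
  hom F G / G.totalWeight ^ Fintype.card U

/-- Left convergence: `t(F,G_n)` converges for every finite simple graph `F`. -/
def IsLeftConvergent (G : ℕ → WeightedGraph.{u}) : Prop :=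
  ∀ (U : Type) [Fintype U] (F : SimpleGraph U),
    ∃ l : ℝ, Tendsto (fun n => homDensity F (G n)) atTop (𝓝 l)

/-- `e(S,T) = ∑_{i ∈ S, j ∈ T} α_i α_j β_{ij}`, for nodeweights `α` and edgeweights `β`. -/
def cutWeight {V : Type u} (α : V → ℝ) (β : V → V → ℝ) (S T : Finset V) : ℝ :=
  ∑ i ∈ S, ∑ j ∈ T, α i * α j * β i j

/-- The labeled cut distance
`d_□ = max_{S,T ⊆ V} |e_β(S,T) - e_{β'}(S,T)| / (∑ i, α_i) ^ 2`
of two graphs on the same node set `V`, with the same nodeweights `α`, and with edgeweights `β`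
and `β'`. (The nodeweights are allowed to vanish, since overlaid graphs may have such nodes.) -/
def labeledCutDist {V : Type u} [Fintype V] (α : V → ℝ) (β β' : V → V → ℝ) : ℝ :=
  (Finset.univ : Finset (Finset V × Finset V)).sup' Finset.univ_nonempty fun P =>
    |cutWeight α β P.1 P.2 - cutWeight α β' P.1 P.2| / (∑ i, α i) ^ 2

/-- The graph obtained by dividing all nodeweights by the total nodeweight. -/
def normalize (G : WeightedGraph.{u}) : WeightedGraph.{u} where
  V := G.V
  nodeWeight i := G.nodeWeight i / G.totalWeight
  edgeWeight := G.edgeWeight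
  nodeWeight_pos i := div_pos (G.nodeWeight_pos i) G.totalWeight_pos
  edgeWeight_symm := G.edgeWeight_symm

theorem totalWeight_normalize (G : WeightedGraph.{u}) : G.normalize.totalWeight = 1 := by
  change ∑ i, G.nodeWeight i / G.totalWeight = 1
  rw [← Finset.sum_div]
  exact div_self G.totalWeight_pos.ne'

/-- The fractional overlays of two weighted graphs (of total nodeweight one): the nonnegative
matrices whose row sums and column sums are the nodeweights of `G` and `G'`. -/
def fractionalOverlays (G : WeightedGraph.{u}) (G' : WeightedGraph.{v}) :
    Set (Matrix G.V G'.V ℝ) :=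
  {X | (∀ i w, 0 ≤ X i w) ∧ (∀ i, ∑ w, X i w = G.nodeWeight i) ∧
    ∀ w, ∑ i, X i w = G'.nodeWeight w}

/-- The distance `d_□(G[X], G'[Xᵀ])` of the two overlaid graphs: they have node set
`V(G) × V(G')`, nodeweights `X_{iw}`, and edgeweights `β_{ij}` and `β'_{wz}` on the pair
`((i,w),(j,z))`. -/
def overlayDist (G : WeightedGraph.{u}) (G' : WeightedGraph.{v}) (X : Matrix G.V G'.V ℝ) : ℝ :=
  labeledCutDist (V := G.V × G'.V) (fun p => X p.1 p.2)
    (fun p q => G.edgeWeight p.1 q.1) (fun p q => G'.edgeWeight p.2 q.2)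

/-- The cut distance: the minimum of `d_□(G[X], G'[Xᵀ])` over all fractional overlays `X` of the
graphs rescaled to total nodeweight one. The infimum is a minimum, see
`WeightedGraph.exists_overlayDist_eq_cutDist`. -/
def cutDist (G : WeightedGraph.{u}) (G' : WeightedGraph.{v}) : ℝ :=
  sInf (overlayDist G.normalize G'.normalize '' fractionalOverlays G.normalize G'.normalize)

/-- Being a Cauchy sequence in the cut distance. -/
def IsCutCauchy (G : ℕ → WeightedGraph.{u}) : Prop :=
  ∀ ε : ℝ, 0 < ε → ∃ N : ℕ, ∀ m ≥ N, ∀ n ≥ N, cutDist (G m) (G n) < ε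

/-- The edgeweights of the graphs in the sequence are uniformly bounded. -/
def HasBoundedEdgeWeights (G : ℕ → WeightedGraph.{u}) : Prop :=
  ∃ C : ℝ, ∀ n, ∀ i j : (G n).V, |(G n).edgeWeight i j| ≤ C

theorem sum_overlay {G : WeightedGraph.{u}} {G' : WeightedGraph.{v}} {X : Matrix G.V G'.V ℝ}
    (hX : X ∈ fractionalOverlays G G') : ∑ p : G.V × G'.V, X p.1 p.2 = G.totalWeight := by
  rw [Fintype.sum_prod_type]
  exact Finset.sum_congr rfl fun i _ => hX.2.1 i

theorem fractionalOverlays_nonempty (G : WeightedGraph.{u}) (G' : WeightedGraph.{v}) :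
    (fractionalOverlays G.normalize G'.normalize).Nonempty := by
  refine ⟨fun i w => G.normalize.nodeWeight i * G'.normalize.nodeWeight w, ?_, ?_, ?_⟩
  · exact fun i w => (mul_pos (G.normalize.nodeWeight_pos i) (G'.normalize.nodeWeight_pos w)).le
  · intro i
    rw [← Finset.mul_sum]
    exact (congrArg _ G'.totalWeight_normalize).trans (mul_one _)
  · intro w
    rw [← Finset.sum_mul]
    exact (congrArg (· * _) G.totalWeight_normalize).trans (one_mul _)

theorem isCompact_fractionalOverlays (G : WeightedGraph.{u}) (G' : WeightedGraph.{v}) :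
    IsCompact (fractionalOverlays G G') := by
  refine IsCompact.of_isClosed_subset
    (isCompact_univ_pi fun i : G.V => isCompact_univ_pi fun _ : G'.V =>
      isCompact_Icc (a := (0 : ℝ)) (b := G.nodeWeight i)) ?_ ?_
  · have h (i : G.V) (w : G'.V) : Continuous fun X : Matrix G.V G'.V ℝ => X i w :=
      continuous_id.matrix_elem i w
    simp only [fractionalOverlays, Set.ofPred_and, Set.ofPred_forall]
    refine (isClosed_iInter fun i => isClosed_iInter fun w =>
      isClosed_le continuous_const (h i w)).inter (IsClosed.inter ?_ ?_)
    · exact isClosed_iInter fun i =>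
        isClosed_eq (continuous_finsetSum _ fun w _ => h i w) continuous_const
    · exact isClosed_iInter fun w =>
        isClosed_eq (continuous_finsetSum _ fun i _ => h i w) continuous_const
  · intro X hX i _ w _
    refine ⟨hX.1 i w, ?_⟩
    rw [← hX.2.1 i]
    exact Finset.single_le_sum (fun z _ => hX.1 i z) (Finset.mem_univ w)

theorem exists_overlayDist_eq_cutDist (G : WeightedGraph.{u}) (G' : WeightedGraph.{v}) :
    ∃ X ∈ fractionalOverlays G.normalize G'.normalize,
      overlayDist G.normalize G'.normalize X = cutDist G G' ∧
      ∀ Y ∈ fractionalOverlays G.normalize G'.normalize,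
        cutDist G G' ≤ overlayDist G.normalize G'.normalize Y := by
  have hc : ContinuousOn (overlayDist G.normalize G'.normalize)
      (fractionalOverlays G.normalize G'.normalize) := by
    refine ContinuousOn.finset_sup'_apply Finset.univ_nonempty fun P _ => ?_
    refine ContinuousOn.div ?_ ?_ fun X hX => ?_
    · refine Continuous.continuousOn ?_
      simp only [cutWeight]
      have h (i : G.normalize.V) (w : G'.normalize.V) :
          Continuous fun X : Matrix G.normalize.V G'.normalize.V ℝ => X i w :=
        continuous_id.matrix_elem i w
      fun_prop
    · refine Continuous.continuousOn ?_
      have h (i : G.normalize.V) (w : G'.normalize.V) :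
          Continuous fun X : Matrix G.normalize.V G'.normalize.V ℝ => X i w :=
        continuous_id.matrix_elem i w
      fun_prop
    · rw [sum_overlay hX, totalWeight_normalize]
      norm_num
  have hK := (isCompact_fractionalOverlays G.normalize G'.normalize).image_of_continuousOn hc
  obtain ⟨X, hX, h⟩ := hK.sInf_mem ((fractionalOverlays_nonempty G G').image _)
  exact ⟨X, hX, h, fun Y hY => csInf_le hK.bddBelow ⟨Y, hY, rfl⟩⟩

end WeightedGraph

end

/-!
A Cauchy sequence in the cut distance is left-convergent by the counting lemma
(`abs_homDensity_sub_le`). After two graphs are overlaid, replacing the edgeweights of one by those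
of the other along a single edge of `F` changes the homomorphism density by at most a multiple of
the cut norm of the difference: once all other nodes of `F` are placed, the remaining factors depend
on one endpoint of that edge each, because `F` is simple.

For the converse, a graph `G` with edgeweights bounded by `C` is compared with random graphs on `k`
nodes: choose `k` independent random nodes of `G`, and give each pair of them the weight `± C`, with
independent random signs whose means reproduce the edgeweights of `G`. Two facts carry the proof.

* The distribution of this random graph is polynomial in the densities `t(F, G)` of the simple
  graphs `F` on `k` nodes, so it converges along a left-convergent sequence
  (`IsLeftConvergent.exists_tendsto_sampleProb`).
* For large `k`, the expected cut distance between `G` and its random graph is small, uniformly in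
  `G` (`exists_sum_sampleProb_mul_cutDist_le`).

Hence, for large `m` and `n`, some graph on `k` nodes is close to both `G_m` and `G_n`, and a
triangle inequality (`cutDist_le_of_common`) finishes the proof.

The second fact follows from weak regularity (`exists_step_approx`). Let `f` be a step kernel with
boundedly many steps that is close to `G` in cut norm. The density of four-cycles bounds the cut
norm (`cutBound_of_cycleDensity`), is in turn bounded by it for bounded kernels, and is an average
over quadruples of nodes; therefore its expectation for the difference between the random graph and
the sampled `f` is at most that for `G - f`, up to `O(1/k)`
(`sum_sample_cycleDensity_le`). So sampling preserves closeness to `f` without any concentration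
inequality for cut norms. Finally, `f` and the sampled `f` have the same step values and, by a
second moment bound, nearly the same step sizes, so that a coupling which mostly respects the steps
(`exists_coupling`) is a good overlay.

All probabilities are finite sums, weighted by products of nodeweights.
-/

noncomputable section

namespace WeightedGraph

/-! ### Cut norm bounds -/

/-- `CutBound α D ε` says that the cut norm of the kernel `D` on the finite measure space `(V, α)`
is at most `ε`. The norm is taken over signed weightings dominated by `α` rather than over pairs of
subsets of `V`; the two versions differ by a factor of at most four. -/
def CutBound {V : Type*} [Fintype V] (α : V → ℝ) (D : V → V → ℝ) (ε : ℝ) : Prop :=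
  ∀ a b : V → ℝ, (∀ v, |a v| ≤ α v) → (∀ v, |b v| ≤ α v) →
    |∑ v, ∑ w, a v * b w * D v w| ≤ ε

theorem abs_sum_mul_le_two_mul {V : Type*} [Fintype V] {α d a : V → ℝ} {ε : ℝ}
    (ha : ∀ v, |a v| ≤ α v) (h : ∀ S : Finset V, |∑ v ∈ S, α v * d v| ≤ ε) :
    |∑ v, a v * d v| ≤ 2 * ε := by
  classical
  have h1 := abs_le.1 (h (Finset.univ.filter fun v => 0 ≤ d v))
  have h2 := abs_le.1 (h (Finset.univ.filter fun v => ¬ 0 ≤ d v))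
  calc |∑ v, a v * d v| ≤ ∑ v, α v * |d v| := by
        refine (Finset.abs_sum_le_sum_abs _ _).trans (Finset.sum_le_sum fun v _ => ?_)
        rw [abs_mul]
        exact mul_le_mul_of_nonneg_right (ha v) (abs_nonneg _)
    _ = ∑ v with 0 ≤ d v, α v * d v - ∑ v with ¬ 0 ≤ d v, α v * d v := by
        rw [← Finset.sum_filter_add_sum_filter_not Finset.univ (fun v => 0 ≤ d v),
          sub_eq_add_neg, ← Finset.sum_neg_distrib]
        congr 1 <;> refine Finset.sum_congr rfl fun v hv => ?_
        · rw [abs_of_nonneg (Finset.mem_filter.1 hv).2]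
        · rw [abs_of_neg (not_le.1 (Finset.mem_filter.1 hv).2), mul_neg]
    _ ≤ 2 * ε := by linarith

theorem CutBound.of_finset {V : Type*} [Fintype V] {α : V → ℝ} {D : V → V → ℝ} {ε : ℝ}
    (h : ∀ S T : Finset V, |∑ v ∈ S, ∑ w ∈ T, α v * α w * D v w| ≤ ε) :
    CutBound α D (4 * ε) := by
  intro a b ha hb
  have h1 (T : Finset V) : |∑ w ∈ T, α w * ∑ v, a v * D v w| ≤ 2 * ε := by
    have := abs_sum_mul_le_two_mul (d := fun v => ∑ w ∈ T, α w * D v w) ha (ε := ε) fun S => by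
      refine le_of_eq_of_le ?_ (h S T)
      simp only [Finset.mul_sum, mul_assoc]
    refine le_of_eq_of_le ?_ this
    simp only [Finset.mul_sum]
    rw [Finset.sum_comm]
    simp only [mul_left_comm]
  have h2 := abs_sum_mul_le_two_mul hb h1
  refine le_of_eq_of_le ?_ (h2.trans_eq (by ring))
  rw [Finset.sum_comm]
  simp only [Finset.mul_sum]
  congr 1
  exact Finset.sum_congr rfl fun w _ => Finset.sum_congr rfl fun v _ => by ring

theorem CutBound.abs_sum_finset_le {V : Type*} [Fintype V] {α : V → ℝ} {D : V → V → ℝ} {ε : ℝ}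
    (hα : ∀ v, 0 ≤ α v) (h : CutBound α D ε) (S T : Finset V) :
    |∑ v ∈ S, ∑ w ∈ T, α v * α w * D v w| ≤ ε := by
  classical
  have key (R : Finset V) (v : V) : |if v ∈ R then α v else 0| ≤ α v := by
    split_ifs
    · rw [abs_of_nonneg (hα v)]
    · simpa using hα v
  refine le_of_eq_of_le ?_ (h (fun v => if v ∈ S then α v else 0)
    (fun v => if v ∈ T then α v else 0) (key S) (key T))
  congr 1
  calc _ = ∑ v, if v ∈ S then ∑ w, if w ∈ T then α v * α w * D v w else 0 else 0 := by
        simp [Finset.sum_ite_mem]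
    _ = _ := by
        refine Finset.sum_congr rfl fun v _ => ?_
        split_ifs
        · exact Finset.sum_congr rfl fun w _ => by split_ifs <;> simp
        · simp

/-- A cut norm bound on a space controls test weightings on any space over it. -/
theorem CutBound.abs_sum_comp_le {V Y : Type*} [Fintype V] [Fintype Y] [DecidableEq V]
    {α : V → ℝ} {D : V → V → ℝ} {ε : ℝ} (h : CutBound α D ε) (π : Y → V) {s t : Y → ℝ}
    (hs : ∀ v, ∑ y with π y = v, |s y| ≤ α v) (ht : ∀ v, ∑ y with π y = v, |t y| ≤ α v) :
    |∑ y, ∑ z, s y * t z * D (π y) (π z)| ≤ ε := by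
  refine le_of_eq_of_le ?_ (h (fun v => ∑ y with π y = v, s y) (fun v => ∑ y with π y = v, t y)
    (fun v => (Finset.abs_sum_le_sum_abs _ _).trans (hs v))
    (fun v => (Finset.abs_sum_le_sum_abs _ _).trans (ht v)))
  congr 1
  rw [← Finset.sum_fiberwise Finset.univ π]
  refine Finset.sum_congr rfl fun v _ => ?_
  calc _ = ∑ y with π y = v, ∑ w, ∑ z with π z = w, s y * t z * D v w := by
        refine Finset.sum_congr rfl fun y hy => ?_
        rw [← Finset.sum_fiberwise Finset.univ π]
        refine Finset.sum_congr rfl fun w _ => Finset.sum_congr rfl fun z hz => ?_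
        rw [(Finset.mem_filter.1 hy).2, (Finset.mem_filter.1 hz).2]
    _ = _ := by
        rw [Finset.sum_comm]
        simp only [Finset.sum_mul, Finset.mul_sum]
        refine Finset.sum_congr rfl fun w _ => ?_
        rw [Finset.sum_comm]

/-! ### Overlays and the cut distance -/

theorem overlayDist_le {G : WeightedGraph.{u}} {G' : WeightedGraph.{v}}
    {X : Matrix G.V G'.V ℝ} {ε : ℝ} (hX : X ∈ fractionalOverlays G G') (hG : G.totalWeight = 1)
    (h : ∀ S T : Finset (G.V × G'.V), |∑ p ∈ S, ∑ q ∈ T, X p.1 p.2 * X q.1 q.2 *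
      (G.edgeWeight p.1 q.1 - G'.edgeWeight p.2 q.2)| ≤ ε) :
    overlayDist G G' X ≤ ε := by
  unfold overlayDist labeledCutDist
  refine Finset.sup'_le _ _ fun P _ => ?_
  rw [sum_overlay hX, hG, one_pow, div_one]
  refine le_of_eq_of_le ?_ (h P.1 P.2)
  simp only [cutWeight, mul_sub, Finset.sum_sub_distrib]

theorem cutDist_le {G : WeightedGraph.{u}} {G' : WeightedGraph.{v}}
    {X : Matrix G.V G'.V ℝ} {ε : ℝ} (hX : X ∈ fractionalOverlays G.normalize G'.normalize)
    (h : ∀ S T : Finset (G.V × G'.V), |∑ p ∈ S, ∑ q ∈ T, X p.1 p.2 * X q.1 q.2 *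
      (G.edgeWeight p.1 q.1 - G'.edgeWeight p.2 q.2)| ≤ ε) :
    cutDist G G' ≤ ε := by
  obtain ⟨_, _, _, hmin⟩ := exists_overlayDist_eq_cutDist G G'
  exact (hmin X hX).trans (overlayDist_le hX G.totalWeight_normalize h)

theorem exists_overlay_cutBound (G : WeightedGraph.{u}) (G' : WeightedGraph.{v}) :
    ∃ X ∈ fractionalOverlays G.normalize G'.normalize,
      CutBound (fun p : G.V × G'.V => X p.1 p.2)
        (fun p q => G.edgeWeight p.1 q.1 - G'.edgeWeight p.2 q.2) (4 * cutDist G G') := by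
  obtain ⟨X, hX, hd, _⟩ := exists_overlayDist_eq_cutDist G G'
  refine ⟨X, hX, CutBound.of_finset fun S T => ?_⟩
  have := Finset.le_sup' (fun P : Finset (G.V × G'.V) × Finset (G.V × G'.V) =>
    |cutWeight (fun p => X p.1 p.2) (fun p q => G.edgeWeight p.1 q.1) P.1 P.2 -
      cutWeight (fun p => X p.1 p.2) (fun p q => G'.edgeWeight p.2 q.2) P.1 P.2| /
      (∑ p : G.V × G'.V, X p.1 p.2) ^ 2) (Finset.mem_univ (S, T))
  have h1 : ∑ p : G.V × G'.V, X p.1 p.2 = 1 :=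
    (sum_overlay hX).trans G.totalWeight_normalize
  rw [← hd]
  refine le_trans (le_of_eq ?_) this
  simp only [h1, one_pow, div_one, cutWeight, mul_sub, Finset.sum_sub_distrib]

theorem cutDist_nonneg (G : WeightedGraph.{u}) (G' : WeightedGraph.{v}) : 0 ≤ cutDist G G' := by
  obtain ⟨X, hX, h⟩ := exists_overlay_cutBound G G'
  have := (abs_nonneg _).trans (h 0 0 (fun p => by simpa using hX.1 p.1 p.2)
    (fun p => by simpa using hX.1 p.1 p.2))
  linarith

/-- A weak triangle inequality through a common third graph, by gluing the two optimal overlays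
along it. The constant `4` comes from the two versions of the cut norm. -/
theorem cutDist_le_of_common (G G' : WeightedGraph.{u}) (H : WeightedGraph.{v}) :
    cutDist G G' ≤ 4 * (cutDist G H + cutDist G' H) := by
  classical
  obtain ⟨X, hX, hXb⟩ := exists_overlay_cutBound G H
  obtain ⟨Y, hY, hYb⟩ := exists_overlay_cutBound G' H
  let μ : H.V → ℝ := H.normalize.nodeWeight
  have hμ (u : H.V) : 0 < μ u := H.normalize.nodeWeight_pos u
  have hX2 (u : H.V) : ∑ i : G.V, X i u = μ u := hX.2.2 u
  have hY2 (u : H.V) : ∑ i : G'.V, Y i u = μ u := hY.2.2 u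
  have hX0 (i : G.V) (u : H.V) : 0 ≤ X i u := hX.1 i u
  have hY0 (i : G'.V) (u : H.V) : 0 ≤ Y i u := hY.1 i u
  let W : G.V × G'.V × H.V → ℝ := fun τ => X τ.1 τ.2.2 * Y τ.2.1 τ.2.2 / μ τ.2.2
  have hW0 (τ) : 0 ≤ W τ := div_nonneg (mul_nonneg (hX0 _ _) (hY0 _ _)) (hμ _).le
  have hW1 (i : G.V) (u : H.V) : ∑ w, W (i, w, u) = X i u := by
    simp only [W]
    rw [← Finset.sum_div, ← Finset.mul_sum, hY2, mul_div_cancel_right₀ _ (hμ u).ne']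
  have hW2 (w : G'.V) (u : H.V) : ∑ i, W (i, w, u) = Y w u := by
    simp only [W]
    rw [← Finset.sum_div, ← Finset.sum_mul, hX2, mul_div_cancel_left₀ _ (hμ u).ne']
  let Z : Matrix G.V G'.V ℝ := fun i w => ∑ u, W (i, w, u)
  have hZ : Z ∈ fractionalOverlays G.normalize G'.normalize := by
    refine ⟨fun i w => Finset.sum_nonneg fun u _ => hW0 _, fun i => ?_, fun w => ?_⟩
    · refine Finset.sum_comm.trans (Eq.trans ?_ (hX.2.1 i))
      exact Finset.sum_congr rfl fun u _ => hW1 i u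
    · refine Finset.sum_comm.trans (Eq.trans ?_ (hY.2.1 w))
      exact Finset.sum_congr rfl fun u _ => hW2 w u
  refine cutDist_le hZ fun S T => ?_
  let s (R : Finset (G.V × G'.V)) (τ : G.V × G'.V × H.V) : ℝ :=
    if (τ.1, τ.2.1) ∈ R then W τ else 0
  have hs (R) (τ) : |s R τ| ≤ W τ := by
    simp only [s]
    split_ifs
    · rw [abs_of_nonneg (hW0 _)]
    · simpa using hW0 τ
  have hs1 (R) (p : G.V × H.V) : ∑ τ with (τ.1, τ.2.2) = p, |s R τ| ≤ X p.1 p.2 := by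
    refine (Finset.sum_le_sum fun τ _ => hs R τ).trans_eq ?_
    rw [Finset.sum_filter, Fintype.sum_prod_type]
    simp only [Fintype.sum_prod_type, Prod.ext_iff, ite_and, Finset.sum_ite_irrel,
      Finset.sum_const_zero, Finset.sum_ite_eq', Finset.mem_univ, if_true]
    exact hW1 _ _
  have hs2 (R) (p : G'.V × H.V) : ∑ τ with τ.2 = p, |s R τ| ≤ Y p.1 p.2 := by
    refine (Finset.sum_le_sum fun τ _ => hs R τ).trans_eq ?_
    rw [Finset.sum_filter, Fintype.sum_prod_type]
    simp only [Finset.sum_ite_eq', Finset.mem_univ, if_true]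
    exact hW2 _ _
  have e1 := hXb.abs_sum_comp_le (fun τ : G.V × G'.V × H.V => (τ.1, τ.2.2)) (hs1 S) (hs1 T)
  have e2 := hYb.abs_sum_comp_le (fun τ : G.V × G'.V × H.V => τ.2) (hs2 S) (hs2 T)
  have hsum (f : G.V × G'.V → ℝ) (R) :
      ∑ τ : G.V × G'.V × H.V, s R τ * f (τ.1, τ.2.1) = ∑ p ∈ R, Z p.1 p.2 * f p := by
    calc _ = ∑ p, if p ∈ R then Z p.1 p.2 * f p else 0 := by
          simp only [Fintype.sum_prod_type, Z, s, Finset.sum_mul]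
          refine Finset.sum_congr rfl fun i _ => Finset.sum_congr rfl fun w _ => ?_
          split_ifs <;> simp
      _ = _ := by simp [Finset.sum_ite_mem]
  have hsum2 (f : G.V × G'.V → G.V × G'.V → ℝ) :
      ∑ p ∈ S, ∑ q ∈ T, Z p.1 p.2 * Z q.1 q.2 * f p q =
        ∑ τ, ∑ τ', s S τ * s T τ' * f (τ.1, τ.2.1) (τ'.1, τ'.2.1) := by
    simp only [mul_assoc, ← Finset.mul_sum]
    rw [hsum (fun p => ∑ τ', s T τ' * f p (τ'.1, τ'.2.1))]
    exact Finset.sum_congr rfl fun p _ => by rw [hsum (f p)]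
  rw [hsum2 fun p q => G.edgeWeight p.1 q.1 - G'.edgeWeight p.2 q.2]
  have e3 := (abs_sub _ _).trans (add_le_add e1 e2)
  rw [← Finset.sum_sub_distrib] at e3
  simp only [← Finset.sum_sub_distrib, ← mul_sub, sub_sub_sub_cancel_right] at e3
  exact e3.trans_eq (by ring)

/-! ### Product measures on finite sets -/

theorem sum_prod_pi_eq_one {I V : Type*} [Fintype I] [DecidableEq I] [Fintype V] {p : I → V → ℝ}
    (hp : ∀ i, ∑ v, p i v = 1) : ∑ x : I → V, ∏ i, p i (x i) = 1 := by
  rw [← Fintype.prod_sum]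
  exact Finset.prod_eq_one fun i _ => hp i

/-- Under a product measure, resampling one coordinate does not change expectations. -/
theorem sum_pi_resample {I V : Type*} [Fintype I] [DecidableEq I] [Fintype V] {p : I → V → ℝ}
    (hp : ∀ i, ∑ v, p i v = 1) (a : I) (g : (I → V) → ℝ) :
    ∑ x : I → V, (∏ i, p i (x i)) * g x =
      ∑ x : I → V, (∏ i, p i (x i)) * ∑ v, p a v * g (Function.update x a v) := by
  have hupd (u v : V) (ρ : {j // j ≠ a} → V) :
      Function.update ((Equiv.funSplitAt a V).symm (u, ρ)) a v =
        (Equiv.funSplitAt a V).symm (v, ρ) := by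
    ext j
    by_cases h : j = a
    · subst h; simp [Equiv.funSplitAt, Equiv.piSplitAt]
    · simp [Equiv.funSplitAt, Equiv.piSplitAt, h]
  have hprod (u : V) (ρ : {j // j ≠ a} → V) :
      ∏ i, p i ((Equiv.funSplitAt a V).symm (u, ρ) i) = p a u * ∏ j : {j // j ≠ a}, p j (ρ j) := by
    rw [Fintype.prod_eq_mul_prod_subtype_ne _ a]
    congr 1
    · simp [Equiv.funSplitAt, Equiv.piSplitAt]
    · refine Finset.prod_congr rfl fun j _ => ?_
      simp [Equiv.funSplitAt, Equiv.piSplitAt, j.2]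
  rw [← (Equiv.funSplitAt a V).symm.sum_comp, ← (Equiv.funSplitAt a V).symm.sum_comp,
    Fintype.sum_prod_type, Fintype.sum_prod_type, Finset.sum_comm]
  conv_rhs => rw [Finset.sum_comm]
  refine Finset.sum_congr rfl fun ρ _ => ?_
  simp only [hupd, hprod, mul_assoc]
  rw [← Finset.sum_mul, hp, one_mul, Finset.mul_sum]
  exact Finset.sum_congr rfl fun v _ => by ring

/-- The coordinates of a product measure along an injection form a product measure. -/
theorem sum_pi_comp_injective {I J V : Type*} [Fintype I] [DecidableEq I] [Fintype J]
    [DecidableEq J] [Fintype V] {p : I → V → ℝ}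
    (hp : ∀ i, ∑ v, p i v = 1) {e : J → I} (he : Function.Injective e) (g : (J → V) → ℝ) :
    ∑ x : I → V, (∏ i, p i (x i)) * g (x ∘ e) =
      ∑ y : J → V, (∏ j, p (e j) (y j)) * g y := by
  classical
  let E := Equiv.piEquivPiSubtypeProd (· ∈ Set.range e) (fun _ : I => V)
  let F : (J → V) ≃ ({i // i ∈ Set.range e} → V) :=
    Equiv.arrowCongr (Equiv.ofInjective e he) (Equiv.refl V)
  rw [← E.symm.sum_comp, Fintype.sum_prod_type, ← F.sum_comp]
  refine Finset.sum_congr rfl fun y _ => ?_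
  have h1 (z : {i // i ∉ Set.range e} → V) : E.symm (F y, z) ∘ e = y := by
    ext j
    have : (Equiv.ofInjective e he).symm ⟨e j, Set.mem_range_self j⟩ = j :=
      (Equiv.ofInjective e he).symm_apply_eq.2 rfl
    simp [E, F, Equiv.piEquivPiSubtypeProd, this]
  have h2 (z : {i // i ∉ Set.range e} → V) : ∏ i, p i (E.symm (F y, z) i) =
      (∏ j, p (e j) (y j)) * ∏ i : {i // i ∉ Set.range e}, p i (z i) := by
    rw [← Fintype.prod_subtype_mul_prod_subtype (· ∈ Set.range e)]
    congr 1
    · have h3 (j : J) : p (e j) (y j) = p (e j) (E.symm (F y, z) (e j)) := by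
        rw [show E.symm (F y, z) (e j) = y j from congrFun (h1 z) j]
      simp only [h3]
      convert ((Equiv.ofInjective e he).prod_comp fun i => p i (E.symm (F y, z) i)).symm <;> rfl
    · refine Finset.prod_congr rfl fun j _ => ?_
      have : ¬ ∃ i, e i = j := j.2
      simp [E, Equiv.piEquivPiSubtypeProd, this]
  simp only [h1, h2]
  rw [← Finset.sum_mul, ← Finset.mul_sum,
    sum_prod_pi_eq_one (p := fun i : {i // i ∉ Set.range e} => p i) (fun i => hp i), mul_one]

/-- Independent samples push forward to independent samples. -/
theorem sum_pi_map {I V Y : Type*} [Fintype I] [DecidableEq I] [Fintype V] [DecidableEq V]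
    [Fintype Y] (π : Y → V)
    {q : Y → ℝ} {α : V → ℝ} (h : ∀ v, ∑ y with π y = v, q y = α v) (g : (I → V) → ℝ) :
    ∑ ψ : I → Y, (∏ i, q (ψ i)) * g (π ∘ ψ) = ∑ φ : I → V, (∏ i, α (φ i)) * g φ := by
  classical
  rw [← Finset.sum_fiberwise Finset.univ (fun ψ : I → Y => π ∘ ψ)]
  refine Finset.sum_congr rfl fun φ _ => ?_
  have : (Finset.univ.filter fun ψ : I → Y => π ∘ ψ = φ) =
      Fintype.piFinset fun i => Finset.univ.filter fun y => π y = φ i := by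
    ext ψ
    simp [funext_iff]
  simp only [← h]
  rw [Finset.prod_univ_sum, Finset.sum_mul, ← this]
  exact Finset.sum_congr rfl fun ψ hψ => by rw [(Finset.mem_filter.1 hψ).2]

/-- If, once the coordinates other than `a` and `b` are frozen, the integrand factors as a kernel of small cut norm
times bounded functions of one variable each, then the expectation is small. -/
theorem CutBound.abs_sum_pi_le {U Y : Type*} [Fintype U] [DecidableEq U]
    [Fintype Y] {q : Y → ℝ}
    (hq0 : ∀ y, 0 ≤ q y) (hq1 : ∑ y, q y = 1) {D : Y → Y → ℝ} {ε : ℝ} (h : CutBound q D ε)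
    (a b : U) {s t : (U → Y) → Y → ℝ} (hs : ∀ ψ y, |s ψ y| ≤ 1) (ht : ∀ ψ y, |t ψ y| ≤ 1)
    {g : (U → Y) → ℝ}
    (hg : ∀ ψ y z, g (Function.update (Function.update ψ a y) b z) = s ψ y * t ψ z * D y z) :
    |∑ ψ : U → Y, (∏ i, q (ψ i)) * g ψ| ≤ ε := by
  rw [sum_pi_resample (p := fun _ : U => q) (fun _ => hq1) b,
    sum_pi_resample (p := fun _ : U => q) (fun _ => hq1) a]
  calc _ ≤ ∑ ψ : U → Y, (∏ i, q (ψ i)) * ε := by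
        refine (Finset.abs_sum_le_sum_abs _ _).trans (Finset.sum_le_sum fun ψ _ => ?_)
        rw [abs_mul, abs_of_nonneg (Finset.prod_nonneg fun i _ => hq0 _)]
        refine mul_le_mul_of_nonneg_left ?_ (Finset.prod_nonneg fun i _ => hq0 _)
        have key (r : Y → ℝ) (hr : ∀ y, |r y| ≤ 1) (y : Y) : |q y * r y| ≤ q y := by
          rw [abs_mul, abs_of_nonneg (hq0 y)]
          exact mul_le_of_le_one_right (hq0 y) (hr y)
        refine le_of_eq_of_le ?_ (h _ _ (key (s ψ) (hs ψ)) (key (t ψ) (ht ψ)))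
        simp only [hg, Finset.mul_sum]
        congr 1
        exact Finset.sum_congr rfl fun y _ => Finset.sum_congr rfl fun z _ => by ring
    _ = ε := by
        rw [← Finset.sum_mul, sum_prod_pi_eq_one (p := fun _ : U => q) (fun _ => hq1), one_mul]

/-! ### The counting lemma -/

theorem sym2_map_update_of_notMem {U Y : Type*} [DecidableEq U] {e : Sym2 U} {a : U} (h : a ∉ e)
    (ψ : U → Y) (y : Y) : e.map (Function.update ψ a y) = e.map ψ := by
  refine Sym2.map_congr fun x hx => ?_
  rw [Function.update_of_ne]
  rintro rfl
  exact h hx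

theorem CutBound.abs_sum_edge_le {U Y : Type*} [Fintype U] [DecidableEq U]
    [Fintype Y] {q : Y → ℝ}
    (hq0 : ∀ y, 0 ≤ q y) (hq1 : ∑ y, q y = 1) {A B : Sym2 Y → ℝ} {ε : ℝ}
    (h : CutBound q (fun y z => A s(y, z) - B s(y, z)) ε) {K : Sym2 U → Sym2 Y → ℝ}
    (hK : ∀ e p, |K e p| ≤ 1) {e : Sym2 U} (he : ¬ e.IsDiag) {E : Finset (Sym2 U)} (heE : e ∉ E) :
    |∑ ψ : U → Y, (∏ i, q (ψ i)) *
      ((A (e.map ψ) - B (e.map ψ)) * ∏ e' ∈ E, K e' (e'.map ψ))| ≤ ε := by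
  classical
  induction e with | _ a b
  have hab : a ≠ b := by simpa using he
  have habs (E' : Finset (Sym2 U)) (ψ : U → Y) : |∏ e' ∈ E', K e' (e'.map ψ)| ≤ 1 := by
    rw [Finset.abs_prod]
    exact Finset.prod_le_one (fun _ _ => abs_nonneg _) fun _ _ => hK _ _
  refine h.abs_sum_pi_le hq0 hq1 a b
    (s := fun ψ y => ∏ e' ∈ E with a ∈ e', K e' (e'.map (Function.update ψ a y)))
    (t := fun ψ z => ∏ e' ∈ E with ¬ a ∈ e', K e' (e'.map (Function.update ψ b z)))
    (fun _ _ => habs _ _) (fun _ _ => habs _ _) fun ψ y z => ?_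
  rw [← Finset.prod_filter_mul_prod_filter_not E (a ∈ ·)]
  have h1 : ∏ e' ∈ E with a ∈ e', K e' (e'.map (Function.update (Function.update ψ a y) b z)) =
      ∏ e' ∈ E with a ∈ e', K e' (e'.map (Function.update ψ a y)) := by
    refine Finset.prod_congr rfl fun e' he' => ?_
    rw [sym2_map_update_of_notMem]
    intro hb
    obtain ⟨he1, he2⟩ := Finset.mem_filter.1 he'
    -- an edge through both `a` and `b` is the distinguished edge, which is not in `E`
    exact heE ((Sym2.mem_and_mem_iff hab).1 ⟨he2, hb⟩ ▸ he1)
  have h2 : ∏ e' ∈ E with ¬ a ∈ e', K e' (e'.map (Function.update (Function.update ψ a y) b z)) =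
      ∏ e' ∈ E with ¬ a ∈ e', K e' (e'.map (Function.update ψ b z)) := by
    refine Finset.prod_congr rfl fun e' he' => ?_
    rw [Function.update_comm hab, sym2_map_update_of_notMem (Finset.mem_filter.1 he').2]
  rw [h1, h2]
  simp only [Sym2.map_mk, Function.update_self, Function.update_of_ne hab]
  ring

/-- The counting lemma for kernels bounded by one: replacing the kernel on the edges of a simple
graph one at a time changes the homomorphism density by at most the cut norm each time. -/
theorem CutBound.abs_sum_prod_sub_prod_le {U Y : Type*} [Fintype U] [DecidableEq U]
    [Fintype Y] {q : Y → ℝ}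
    (hq0 : ∀ y, 0 ≤ q y) (hq1 : ∑ y, q y = 1) {A B : Sym2 Y → ℝ} (hA : ∀ p, |A p| ≤ 1)
    (hB : ∀ p, |B p| ≤ 1) {ε : ℝ} (h : CutBound q (fun y z => A s(y, z) - B s(y, z)) ε)
    (E : Finset (Sym2 U)) (hE : ∀ e ∈ E, ¬ e.IsDiag) :
    |∑ ψ : U → Y, (∏ i, q (ψ i)) * (∏ e ∈ E, A (e.map ψ) - ∏ e ∈ E, B (e.map ψ))| ≤
      E.card * ε := by
  classical
  suffices H : ∀ E : Finset (Sym2 U), (∀ e ∈ E, ¬ e.IsDiag) → ∀ E₀ : Finset (Sym2 U),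
      Disjoint E E₀ → ∀ K : Sym2 U → Sym2 Y → ℝ, (∀ e p, |K e p| ≤ 1) →
      |∑ ψ : U → Y, (∏ i, q (ψ i)) * ((∏ e ∈ E, A (e.map ψ) - ∏ e ∈ E, B (e.map ψ)) *
        ∏ e ∈ E₀, K e (e.map ψ))| ≤ E.card * ε by
    simpa using H E hE ∅ (by simp) (fun _ _ => 1) (by simp)
  clear hE E
  intro E
  induction E using Finset.induction_on with
  | empty => simp
  | insert e E he ih =>
    intro hE E₀ hd K hK
    obtain ⟨he0, hd⟩ := Finset.disjoint_insert_left.1 hd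
    have h1 := ih (fun e' h' => hE e' (Finset.mem_insert_of_mem h')) (insert e E₀)
      (Finset.disjoint_insert_right.2 ⟨he, hd⟩) (fun e' => if e' = e then A else K e')
      (fun e' p => by
        split_ifs
        exacts [hA p, hK e' p])
    have h2 := h.abs_sum_edge_le hq0 hq1 (K := fun e' => if e' ∈ E then B else K e')
      (fun e' p => by
        split_ifs
        exacts [hB p, hK e' p]) (hE e (Finset.mem_insert_self _ _)) (E := E ∪ E₀)
      (by simp [he, he0])
    have hr1 (ψ : U → Y) : ∏ e' ∈ insert e E₀, (if e' = e then A else K e') (e'.map ψ) =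
        A (e.map ψ) * ∏ e' ∈ E₀, K e' (e'.map ψ) := by
      rw [Finset.prod_insert he0, if_pos rfl]
      congr 1
      refine Finset.prod_congr rfl fun e' h' => ?_
      rw [if_neg]
      rintro rfl
      exact he0 h'
    have hr2 (ψ : U → Y) : ∏ e' ∈ E ∪ E₀, (if e' ∈ E then B else K e') (e'.map ψ) =
        (∏ e' ∈ E, B (e'.map ψ)) * ∏ e' ∈ E₀, K e' (e'.map ψ) := by
      rw [Finset.prod_union hd]
      congr 1 <;> refine Finset.prod_congr rfl fun e' h' => ?_
      · rw [if_pos h']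
      · rw [if_neg (Finset.disjoint_right.1 hd h')]
    simp only [hr1] at h1
    simp only [hr2] at h2
    rw [Finset.card_insert_of_notMem he, Nat.cast_succ, add_one_mul]
    refine le_trans (le_of_eq_of_le ?_ (abs_add_le _ _)) (add_le_add h1 h2)
    rw [← Finset.sum_add_distrib]
    congr 1
    refine Finset.sum_congr rfl fun ψ _ => ?_
    rw [Finset.prod_insert he, Finset.prod_insert he]
    ring

theorem pairWeight_mk (G : WeightedGraph.{u}) (i j : G.V) :
    G.pairWeight s(i, j) = G.edgeWeight i j := rfl

theorem homDensity_eq {U : Type*} [Fintype U] [DecidableEq U] (F : SimpleGraph U)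
    [Fintype F.edgeSet] (G : WeightedGraph.{u}) :
    homDensity F G = ∑ φ : U → G.V, (∏ i, G.normalize.nodeWeight (φ i)) *
      ∏ e ∈ F.edgeFinset, G.pairWeight (e.map φ) := by
  rw [homDensity, hom, Finset.sum_div]
  refine Finset.sum_congr (by ext; simp) fun φ _ => ?_
  change _ = (∏ i, G.nodeWeight (φ i) / G.totalWeight) * _
  rw [Finset.prod_div_distrib, Finset.prod_const, Finset.card_univ, mul_div_right_comm]
  congr!

open Classical in
theorem abs_homDensity_sub_le {U : Type*} [Fintype U] (F : SimpleGraph U) {C : ℝ} (hC : 0 < C)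
    {G G' : WeightedGraph.{u}} (hG : ∀ i j, |G.edgeWeight i j| ≤ C)
    (hG' : ∀ i j, |G'.edgeWeight i j| ≤ C) :
    |homDensity F G - homDensity F G'| ≤
      C ^ F.edgeFinset.card * (F.edgeFinset.card * (4 * cutDist G G' / C)) := by
  obtain ⟨X, hX, hb⟩ := exists_overlay_cutBound G G'
  let A : Sym2 (G.V × G'.V) → ℝ := fun p => G.pairWeight (p.map Prod.fst) / C
  let B : Sym2 (G.V × G'.V) → ℝ := fun p => G'.pairWeight (p.map Prod.snd) / C
  have hA (p) : |A p| ≤ 1 := by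
    induction p with | _ y z
    simpa [A, abs_div, abs_of_pos hC, div_le_one hC, pairWeight_mk] using hG y.1 z.1
  have hB (p) : |B p| ≤ 1 := by
    induction p with | _ y z
    simpa [B, abs_div, abs_of_pos hC, div_le_one hC, pairWeight_mk] using hG' y.2 z.2
  have hAB : CutBound (fun p : G.V × G'.V => X p.1 p.2) (fun y z => A s(y, z) - B s(y, z))
      (4 * cutDist G G' / C) := by
    intro a b ha hb'
    have := div_le_div_of_nonneg_right (hb a b ha hb') hC.le
    refine le_of_eq_of_le ?_ this
    rw [show ∀ x : ℝ, |x| / C = |x / C| from fun x => by rw [abs_div, abs_of_pos hC],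
      Finset.sum_div]
    congr 1
    refine Finset.sum_congr rfl fun y _ => ?_
    rw [Finset.sum_div]
    refine Finset.sum_congr rfl fun z _ => ?_
    simp only [A, B, Sym2.map_mk, pairWeight_mk]
    ring
  have hX1 : ∑ p : G.V × G'.V, X p.1 p.2 = 1 :=
    (sum_overlay hX).trans G.totalWeight_normalize
  have key := hAB.abs_sum_prod_sub_prod_le (fun p => hX.1 p.1 p.2) hX1 hA hB F.edgeFinset
    (fun e he => F.not_isDiag_of_mem_edgeFinset he)
  let x : G.V → G'.V → ℝ := X
  have hx1 (i : G.V) : ∑ w, x i w = G.normalize.nodeWeight i := hX.2.1 i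
  have hx2 (w : G'.V) : ∑ i, x i w = G'.normalize.nodeWeight w := hX.2.2 w
  have t1 := sum_pi_map (I := U) (Prod.fst : G.V × G'.V → G.V) (q := fun p => x p.1 p.2)
    (α := G.normalize.nodeWeight) (fun v => by
      rw [Finset.sum_filter, Fintype.sum_prod_type]
      simpa [Finset.sum_ite_irrel] using hx1 v)
    (fun φ => ∏ e ∈ F.edgeFinset, G.pairWeight (e.map φ))
  have t2 := sum_pi_map (I := U) (Prod.snd : G.V × G'.V → G'.V) (q := fun p => x p.1 p.2)
    (α := G'.normalize.nodeWeight) (fun v => by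
      rw [Finset.sum_filter, Fintype.sum_prod_type]
      simpa using hx2 v)
    (fun φ => ∏ e ∈ F.edgeFinset, G'.pairWeight (e.map φ))
  rw [homDensity_eq, homDensity_eq, ← t1, ← t2, ← Finset.sum_sub_distrib]
  refine le_of_eq_of_le ?_ (mul_le_mul_of_nonneg_left key (pow_nonneg hC.le _))
  rw [← abs_of_nonneg (pow_nonneg hC.le _), ← abs_mul, Finset.mul_sum]
  congr 1
  refine Finset.sum_congr rfl fun ψ _ => ?_
  simp only [A, B, Finset.prod_div_distrib, Finset.prod_const, Sym2.map_map]
  change _ = _ * ((∏ i, x (ψ i).1 (ψ i).2) * _)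
  field_simp

theorem IsCutCauchy.isLeftConvergent {G : ℕ → WeightedGraph.{u}} (hG : HasBoundedEdgeWeights G)
    (h : IsCutCauchy G) : IsLeftConvergent G := by
  classical
  intro U _ F
  obtain ⟨C₀, hC₀⟩ := hG
  obtain ⟨C, hC, hGC⟩ : ∃ C : ℝ, 0 < C ∧ ∀ n i j, |(G n).edgeWeight i j| ≤ C :=
    ⟨max C₀ 1, by positivity, fun n i j => (hC₀ n i j).trans (le_max_left _ _)⟩
  refine cauchySeq_tendsto_of_complete (Metric.cauchySeq_iff.2 fun ε hε => ?_)
  let M : ℝ := C ^ F.edgeFinset.card * (F.edgeFinset.card * (4 / C))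
  have hM : 0 ≤ M := by positivity
  obtain ⟨N, hN⟩ := h (ε / (M + 1)) (by positivity)
  refine ⟨N, fun m hm n hn => ?_⟩
  rw [Real.dist_eq]
  calc _ ≤ M * cutDist (G m) (G n) :=
        (abs_homDensity_sub_le F hC (hGC m) (hGC n)).trans_eq (by simp only [M]; ring)
    _ ≤ M * (ε / (M + 1)) := mul_le_mul_of_nonneg_left (hN m hm n hn).le hM
    _ < ε := by
        rw [← mul_div_assoc, div_lt_iff₀ (by positivity)]
        nlinarith

/-! ### Weak regularity -/

/-- The energy decrement step of weak regularity: if a kernel `f` correlates badly with `β` on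
`S × T`, then moving it by `±η` there and truncating brings it closer to `β` in `L²`. Truncation is
harmless because `β` itself is bounded by `C`. -/
theorem sum_sq_sub_clamp_le {V : Type*} [Fintype V] {α : V → ℝ} (hα0 : ∀ v, 0 ≤ α v)
    (hα1 : ∑ v, α v = 1) {C η : ℝ} (hη : 0 < η) {β f : V → V → ℝ}
    (hβ : ∀ v w, |β v w| ≤ C) {S T : Finset V} [DecidableEq V]
    (h : η < |∑ v ∈ S, ∑ w ∈ T, α v * α w * (β v w - f v w)|) :
    ∃ c : ℝ, ∑ v, ∑ w, α v * α w *
        (β v w - max (-C) (min C (f v w + if v ∈ S ∧ w ∈ T then c else 0))) ^ 2 ≤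
      ∑ v, ∑ w, α v * α w * (β v w - f v w) ^ 2 - η ^ 2 := by
  let z := ∑ v ∈ S, ∑ w ∈ T, α v * α w * (β v w - f v w)
  obtain ⟨c, hc1, hc2⟩ : ∃ c : ℝ, c ^ 2 = η ^ 2 ∧ c * z = η * |z| := by
    rcases le_total 0 z with hz | hz
    · exact ⟨η, rfl, by rw [abs_of_nonneg hz]⟩
    · exact ⟨-η, by ring, by rw [abs_of_nonpos hz]; ring⟩
  refine ⟨c, ?_⟩
  have hclamp (x y : ℝ) (hx : |x| ≤ C) : (x - max (-C) (min C y)) ^ 2 ≤ (x - y) ^ 2 := by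
    obtain ⟨h1, h2⟩ := abs_le.1 hx
    rw [sq_le_sq]
    rcases le_total C y with h3 | h3
    · rw [min_eq_left h3, max_eq_right (by linarith), abs_le]
      constructor <;> cases abs_cases (x - y) <;> linarith
    · rw [min_eq_right h3]
      rcases le_total (-C) y with h4 | h4
      · rw [max_eq_right h4]
      · rw [max_eq_left h4, abs_le]
        constructor <;> cases abs_cases (x - y) <;> linarith
  let r : V → V → ℝ := fun v w => if v ∈ S ∧ w ∈ T then 1 else 0
  have hz : ∑ v, ∑ w, α v * α w * (r v w * (β v w - f v w)) = z := by
    simp only [r, z, ite_mul, mul_ite, one_mul, zero_mul, mul_zero, ite_and]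
    simp [Finset.sum_ite_irrel, Finset.sum_ite_mem]
  have hr : ∑ v, ∑ w, α v * α w * r v w ≤ 1 := by
    calc _ ≤ ∑ v, ∑ w, α v * α w := by
          refine Finset.sum_le_sum fun v _ => Finset.sum_le_sum fun w _ =>
            mul_le_of_le_one_right (mul_nonneg (hα0 _) (hα0 _)) ?_
          simp only [r]
          split_ifs <;> norm_num
      _ = 1 := by rw [← Finset.sum_mul_sum, hα1, one_mul]
  calc _ ≤ ∑ v, ∑ w, α v * α w * (β v w - (f v w + if v ∈ S ∧ w ∈ T then c else 0)) ^ 2 :=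
        Finset.sum_le_sum fun v _ => Finset.sum_le_sum fun w _ =>
          mul_le_mul_of_nonneg_left (hclamp _ _ (hβ v w)) (mul_nonneg (hα0 _) (hα0 _))
    _ = ∑ v, ∑ w, α v * α w * (β v w - f v w) ^ 2 -
          2 * c * (∑ v, ∑ w, α v * α w * (r v w * (β v w - f v w))) +
          c ^ 2 * ∑ v, ∑ w, α v * α w * r v w := by
        simp only [Finset.mul_sum, ← Finset.sum_sub_distrib, ← Finset.sum_add_distrib]
        refine Finset.sum_congr rfl fun v _ => Finset.sum_congr rfl fun w _ => ?_
        simp only [r]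
        split_ifs <;> ring
    _ ≤ _ := by
        rw [hz, hc1]
        have : η * η ≤ η * |z| := mul_le_mul_of_nonneg_left h.le hη.le
        nlinarith [mul_le_mul_of_nonneg_left hr (sq_nonneg η)]

/-- Weak regularity: every kernel bounded by `C` is within `η` in cut norm of a step kernel bounded
by `C`, whose number of steps depends on `C` and `η` only. -/
theorem exists_step_approx {C η : ℝ} (hC : 0 ≤ C) (hη : 0 < η) :
    ∃ (ι : Type) (_ : Fintype ι), ∀ (V : Type u) [Fintype V] (α : V → ℝ) (β : V → V → ℝ),
      (∀ v, 0 ≤ α v) → ∑ v, α v = 1 → (∀ v w, |β v w| ≤ C) →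
      ∃ (P : V → ι) (g : ι → ι → ℝ), (∀ c d, |g c d| ≤ C) ∧
        ∀ S T : Finset V, |∑ v ∈ S, ∑ w ∈ T, α v * α w * (β v w - g (P v) (P w))| ≤ η := by
  classical
  have H (n : ℕ) : ∃ (ι : Type) (_ : Fintype ι), ∀ (V : Type u) [Fintype V] (α : V → ℝ)
      (β : V → V → ℝ), (∀ v, 0 ≤ α v) → ∑ v, α v = 1 → (∀ v w, |β v w| ≤ C) →
      ∃ (P : V → ι) (g : ι → ι → ℝ), (∀ c d, |g c d| ≤ C) ∧
        ((∀ S T : Finset V, |∑ v ∈ S, ∑ w ∈ T, α v * α w * (β v w - g (P v) (P w))| ≤ η) ∨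
          ∑ v, ∑ w, α v * α w * (β v w - g (P v) (P w)) ^ 2 ≤ C ^ 2 - n * η ^ 2) := by
    induction n with
    | zero =>
      refine ⟨Unit, inferInstance, fun V _ α β hα0 hα1 hβ =>
        ⟨fun _ => (), fun _ _ => 0, by simpa using hC, Or.inr ?_⟩⟩
      calc _ ≤ ∑ v, ∑ w, α v * α w * C ^ 2 := by
            refine Finset.sum_le_sum fun v _ => Finset.sum_le_sum fun w _ =>
              mul_le_mul_of_nonneg_left ?_ (mul_nonneg (hα0 _) (hα0 _))
            rw [sub_zero]
            exact sq_le_sq' (abs_le.1 (hβ v w)).1 (abs_le.1 (hβ v w)).2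
        _ = _ := by
            simp only [← Finset.sum_mul]
            rw [← Finset.sum_mul_sum, hα1]
            simp
    | succ n ih =>
      obtain ⟨ι, _, h⟩ := ih
      refine ⟨ι × Bool × Bool, inferInstance, fun V _ α β hα0 hα1 hβ => ?_⟩
      obtain ⟨P, g, hg, hcut | hen⟩ := h V α β hα0 hα1 hβ
      · exact ⟨fun v => (P v, true, true), fun c d => g c.1 d.1, fun _ _ => hg _ _, Or.inl hcut⟩
      · by_cases hcut : ∀ S T : Finset V,
            |∑ v ∈ S, ∑ w ∈ T, α v * α w * (β v w - g (P v) (P w))| ≤ η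
        · exact ⟨fun v => (P v, true, true), fun c d => g c.1 d.1, fun _ _ => hg _ _, Or.inl hcut⟩
        · push Not at hcut
          obtain ⟨S, T, hST⟩ := hcut
          obtain ⟨c, hc⟩ := sum_sq_sub_clamp_le hα0 hα1 hη hβ hST
          refine ⟨fun v => (P v, decide (v ∈ S), decide (v ∈ T)), fun x y =>
            max (-C) (min C (g x.1 y.1 + if x.2.1 = true ∧ y.2.2 = true then c else 0)),
            fun x y => ?_, Or.inr ?_⟩
          · exact abs_le.2 ⟨le_max_left _ _, max_le (by linarith) (min_le_left _ _)⟩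
          · simp only [decide_eq_true_eq]
            push_cast
            linarith
  obtain ⟨n, hn⟩ := exists_nat_gt (C ^ 2 / η ^ 2)
  obtain ⟨ι, _, h⟩ := H n
  refine ⟨ι, inferInstance, fun V _ α β hα0 hα1 hβ => ?_⟩
  obtain ⟨P, g, hg, hcut | hen⟩ := h V α β hα0 hα1 hβ
  · exact ⟨P, g, hg, hcut⟩
  · have h1 : 0 ≤ ∑ v, ∑ w, α v * α w * (β v w - g (P v) (P w)) ^ 2 :=
      Finset.sum_nonneg fun v _ => Finset.sum_nonneg fun w _ =>
        mul_nonneg (mul_nonneg (hα0 _) (hα0 _)) (sq_nonneg _)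
    rw [div_lt_iff₀ (by positivity)] at hn
    linarith

/-! ### Four-cycles and the cut norm -/

theorem sq_sum_mul_le {V : Type*} [Fintype V] {α a c : V → ℝ} (hα1 : ∑ v, α v = 1)
    (ha : ∀ v, |a v| ≤ α v) : (∑ v, a v * c v) ^ 2 ≤ ∑ v, α v * c v ^ 2 := by
  have hα0 (v : V) : 0 ≤ α v := (abs_nonneg _).trans (ha v)
  let A := ∑ v, α v * |c v|
  have h1 : |∑ v, a v * c v| ≤ A := by
    refine (Finset.abs_sum_le_sum_abs _ _).trans (Finset.sum_le_sum fun v _ => ?_)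
    rw [abs_mul]
    exact mul_le_mul_of_nonneg_right (ha v) (abs_nonneg _)
  have h2 : 0 ≤ ∑ v, α v * (|c v| - A) ^ 2 :=
    Finset.sum_nonneg fun v _ => mul_nonneg (hα0 v) (sq_nonneg _)
  have h3 : ∑ v, α v * (|c v| - A) ^ 2 = ∑ v, α v * c v ^ 2 - A ^ 2 := by
    calc _ = ∑ v, α v * c v ^ 2 - 2 * A * ∑ v, α v * |c v| + A ^ 2 * ∑ v, α v := by
          simp only [Finset.mul_sum, ← Finset.sum_sub_distrib, ← Finset.sum_add_distrib]
          refine Finset.sum_congr rfl fun v _ => ?_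
          rw [← sq_abs (c v)]
          ring
      _ = _ := by rw [hα1]; simp only [A]; ring
  calc _ = |∑ v, a v * c v| ^ 2 := (sq_abs _).symm
    _ ≤ A ^ 2 := pow_le_pow_left₀ (abs_nonneg _) h1 2
    _ ≤ _ := by linarith

/-- The density of four-cycles in the kernel `D`, written as a sum of squared codegrees. -/
def cycleDensity {V : Type*} [Fintype V] (α : V → ℝ) (D : V → V → ℝ) : ℝ :=
  ∑ v, ∑ w, α v * α w * (∑ i, α i * (D i v * D i w)) ^ 2

theorem pow_four_sum_le_cycleDensity {V : Type*} [Fintype V] {α a b : V → ℝ} {D : V → V → ℝ}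
    (hα1 : ∑ v, α v = 1) (ha : ∀ v, |a v| ≤ α v) (hb : ∀ v, |b v| ≤ α v) :
    (∑ v, ∑ w, a v * b w * D v w) ^ 4 ≤ cycleDensity α D := by
  have h1 := sq_sum_mul_le hα1 ha (c := fun v => ∑ w, b w * D v w)
  have h2 := sq_sum_mul_le (V := V × V) (α := fun p => α p.1 * α p.2)
    (a := fun p => b p.1 * b p.2) (c := fun p => ∑ i, α i * (D i p.1 * D i p.2))
    (by rw [Fintype.sum_prod_type, ← Finset.sum_mul_sum, hα1, one_mul])
    (fun p => by
      rw [abs_mul]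
      exact mul_le_mul (hb _) (hb _) (abs_nonneg _) ((abs_nonneg _).trans (hb _)))
  have e1 : ∑ v, a v * ∑ w, b w * D v w = ∑ v, ∑ w, a v * b w * D v w := by
    simp only [Finset.mul_sum, mul_assoc]
  have e2 : ∑ v, α v * (∑ w, b w * D v w) ^ 2 =
      ∑ p : V × V, b p.1 * b p.2 * ∑ i, α i * (D i p.1 * D i p.2) := by
    have h (i : V) : α i * (∑ w, b w * D i w) ^ 2 =
        ∑ p : V × V, b p.1 * b p.2 * (α i * (D i p.1 * D i p.2)) := by
      rw [sq, Finset.sum_mul_sum, Fintype.sum_prod_type, Finset.mul_sum]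
      refine Finset.sum_congr rfl fun v _ => ?_
      rw [Finset.mul_sum]
      exact Finset.sum_congr rfl fun w _ => by ring
    simp only [h, Finset.mul_sum]
    exact Finset.sum_comm
  rw [e1, e2] at h1
  calc _ = ((∑ v, ∑ w, a v * b w * D v w) ^ 2) ^ 2 := by ring
    _ ≤ _ := pow_le_pow_left₀ (sq_nonneg _) h1 2
    _ ≤ _ := h2.trans_eq (Fintype.sum_prod_type _)

/-- The four-cycle density controls the cut norm. The bound is linear in the density, so that it
can be averaged over random kernels. -/
theorem cutBound_of_cycleDensity {V : Type*} [Fintype V] {α : V → ℝ} (hα1 : ∑ v, α v = 1)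
    (D : V → V → ℝ) {θ : ℝ} (hθ : 0 < θ) : CutBound α D (θ + cycleDensity α D / θ ^ 3) := by
  intro a b ha hb
  have h := pow_four_sum_le_cycleDensity (D := D) hα1 ha hb
  set z := ∑ v, ∑ w, a v * b w * D v w
  have hz : z ^ 4 = |z| ^ 3 * |z| := by rw [← pow_succ, (show Even (3 + 1) by decide).pow_abs]
  have h0 : 0 ≤ cycleDensity α D := (by positivity : 0 ≤ z ^ 4).trans h
  rcases le_total |z| θ with h1 | h1
  · have : 0 ≤ cycleDensity α D / θ ^ 3 := by positivity
    linarith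
  · have : |z| ≤ cycleDensity α D / θ ^ 3 := by
      rw [le_div_iff₀ (by positivity)]
      have := mul_le_mul_of_nonneg_right (pow_le_pow_left₀ hθ.le h1 3) (abs_nonneg z)
      linarith
    linarith

/-! ### Couplings that respect colours -/

/-- Two coloured probability spaces can be coupled so that the colours disagree with probability at
most the `ℓ¹`-distance of the two colour distributions: match as much as possible within each
colour, and couple the leftover independently. -/
theorem exists_coupling {V J ι : Type*} [Fintype V] [Fintype J] [Fintype ι] [DecidableEq ι]
    {α : V → ℝ} {μ : J → ℝ} (hα0 : ∀ v, 0 ≤ α v) (hα1 : ∑ v, α v = 1) (hμ0 : ∀ j, 0 ≤ μ j)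
    (hμ1 : ∑ j, μ j = 1) (P : V → ι) (Q : J → ι) :
    ∃ X : V → J → ℝ, (∀ v j, 0 ≤ X v j) ∧ (∀ v, ∑ j, X v j = α v) ∧ (∀ j, ∑ v, X v j = μ j) ∧
      ∑ v, ∑ j, (if P v = Q j then 0 else X v j) ≤
        ∑ c, |∑ v with P v = c, α v - ∑ j with Q j = c, μ j| := by
  set a : ι → ℝ := fun c => ∑ v with P v = c, α v
  set b : ι → ℝ := fun c => ∑ j with Q j = c, μ j
  let m : ι → ℝ := fun c => min (a c) (b c)
  have ha (c) : 0 ≤ a c := Finset.sum_nonneg fun v _ => hα0 v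
  have hb (c) : 0 ≤ b c := Finset.sum_nonneg fun v _ => hμ0 v
  have hm (c) : 0 ≤ m c := le_min (ha c) (hb c)
  -- divisions by an empty colour class are harmless, since then `m c = 0`
  have hma (c) : m c / (a c * b c) * b c = m c / a c := by
    rcases eq_or_ne (b c) 0 with h | h
    · simp [m, h, ha c]
    · field_simp
  have hmb (c) : m c / (a c * b c) * a c = m c / b c := by
    rcases eq_or_ne (a c) 0 with h | h
    · simp [m, h, hb c]
    · field_simp
  have hmaa (c) : m c / a c * a c = m c := by
    rcases eq_or_ne (a c) 0 with h | h
    · simp [m, h, hb c]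
    · field_simp
  have hmbb (c) : m c / b c * b c = m c := by
    rcases eq_or_ne (b c) 0 with h | h
    · simp [m, h, ha c]
    · field_simp
  let X₁ : V → J → ℝ := fun v j =>
    if P v = Q j then α v * μ j * (m (P v) / (a (P v) * b (P v))) else 0
  let r : V → ℝ := fun v => α v * (1 - m (P v) / a (P v))
  let s : J → ℝ := fun j => μ j * (1 - m (Q j) / b (Q j))
  let ρ : ℝ := 1 - ∑ c, m c
  have hr0 (v) : 0 ≤ r v :=
    mul_nonneg (hα0 v) (sub_nonneg.2 (div_le_one_of_le₀ (min_le_left _ _) (ha _)))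
  have hs0 (j) : 0 ≤ s j :=
    mul_nonneg (hμ0 j) (sub_nonneg.2 (div_le_one_of_le₀ (min_le_right _ _) (hb _)))
  have hr1 : ∑ v, r v = ρ := by
    simp only [r, ρ, mul_sub, mul_one, Finset.sum_sub_distrib, hα1]
    congr 1
    rw [← Finset.sum_fiberwise Finset.univ P]
    refine Finset.sum_congr rfl fun c _ => ?_
    rw [← hmaa c, mul_comm, Finset.sum_mul]
    exact Finset.sum_congr rfl fun v hv => by rw [(Finset.mem_filter.1 hv).2]
  have hs1 : ∑ j, s j = ρ := by
    simp only [s, ρ, mul_sub, mul_one, Finset.sum_sub_distrib, hμ1]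
    congr 1
    rw [← Finset.sum_fiberwise Finset.univ Q]
    refine Finset.sum_congr rfl fun c _ => ?_
    rw [← hmbb c, mul_comm, Finset.sum_mul]
    exact Finset.sum_congr rfl fun v hv => by rw [(Finset.mem_filter.1 hv).2]
  have hρ0 : 0 ≤ ρ := hr1 ▸ Finset.sum_nonneg fun v _ => hr0 v
  have hrρ (v) : r v * ρ / ρ = r v := by
    rcases eq_or_ne ρ 0 with h | h
    · have := (Finset.sum_eq_zero_iff_of_nonneg fun v _ => hr0 v).1 (hr1.trans h) v
        (Finset.mem_univ v)
      simp [this]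
    · field_simp
  have hsρ (j) : ρ * s j / ρ = s j := by
    rcases eq_or_ne ρ 0 with h | h
    · have := (Finset.sum_eq_zero_iff_of_nonneg fun v _ => hs0 v).1 (hs1.trans h) j
        (Finset.mem_univ j)
      simp [this]
    · field_simp
  refine ⟨fun v j => X₁ v j + r v * s j / ρ, fun v j => ?_, fun v => ?_, fun j => ?_, ?_⟩
  · refine add_nonneg ?_ (div_nonneg (mul_nonneg (hr0 v) (hs0 j)) hρ0)
    simp only [X₁]
    split_ifs
    · exact mul_nonneg (mul_nonneg (hα0 v) (hμ0 j)) (div_nonneg (hm _) (mul_nonneg (ha _) (hb _)))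
    · exact le_rfl
  · have h1 : ∑ j, X₁ v j = α v * (m (P v) / a (P v)) := by
      simp only [X₁, eq_comm (a := P v)]
      rw [← Finset.sum_filter, ← hma]
      simp only [b, Finset.mul_sum]
      exact Finset.sum_congr rfl fun j _ => by ring
    rw [Finset.sum_add_distrib, h1, ← Finset.sum_div, ← Finset.mul_sum, hs1, hrρ]
    simp only [r]
    ring
  · have h1 : ∑ v, X₁ v j = μ j * (m (Q j) / b (Q j)) := by
      simp only [X₁]
      rw [← Finset.sum_filter, ← hmb]
      simp only [a, Finset.mul_sum]
      refine Finset.sum_congr rfl fun v hv => ?_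
      rw [(Finset.mem_filter.1 hv).2]
      ring
    rw [Finset.sum_add_distrib, h1, ← Finset.sum_div, ← Finset.sum_mul, hr1, hsρ]
    simp only [s]
    ring
  · calc _ ≤ ∑ v, ∑ j, r v * s j / ρ := by
          refine Finset.sum_le_sum fun v _ => Finset.sum_le_sum fun j _ => ?_
          split_ifs with h
          · exact div_nonneg (mul_nonneg (hr0 v) (hs0 j)) hρ0
          · simp [X₁, h]
      _ = ρ := by
          have h (v) : ∑ j, r v * s j / ρ = r v := by
            rw [← Finset.sum_div, ← Finset.mul_sum, hs1, hrρ]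
          simp only [h, hr1]
      _ = ∑ c, (a c - m c) := by
          rw [Finset.sum_sub_distrib, Finset.sum_fiberwise, hα1]
      _ ≤ _ := by
          refine Finset.sum_le_sum fun c _ => ?_
          rcases le_total (a c) (b c) with h | h
          · simp only [m, min_eq_left h, sub_self]
            exact abs_nonneg _
          · simp only [m, min_eq_right h]
            exact le_abs_self _

theorem cutBound_of_abs_le {V : Type*} [Fintype V] {α : V → ℝ} (hα1 : ∑ v, α v = 1)
    {D : V → V → ℝ} {M : ℝ} (hD : ∀ v w, |D v w| ≤ M) : CutBound α D M := by
  intro a b ha hb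
  calc _ ≤ ∑ v, ∑ w, α v * α w * M := by
        refine (Finset.abs_sum_le_sum_abs _ _).trans (Finset.sum_le_sum fun v _ => ?_)
        refine (Finset.abs_sum_le_sum_abs _ _).trans (Finset.sum_le_sum fun w _ => ?_)
        have h1 := (abs_nonneg _).trans (ha v)
        have h2 := (abs_nonneg _).trans (hb w)
        rw [abs_mul, abs_mul]
        exact mul_le_mul (mul_le_mul (ha v) (hb w) (abs_nonneg _) h1) (hD v w) (abs_nonneg _)
          (mul_nonneg h1 h2)
    _ = M := by
        simp only [← Finset.sum_mul]
        rw [← Finset.sum_mul_sum, hα1, one_mul, one_mul]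

/-- Comparing two kernels through step kernels with the same step values: the cut norm errors of
the two approximations add up, together with the mass on which the coupling mixes colours. -/
theorem cutBound_of_coupling {V J ι : Type*} [Fintype V] [Fintype J] [DecidableEq ι]
    {α : V → ℝ} {μ : J → ℝ} {P : V → ι} {Q : J → ι} {X : V → J → ℝ}
    (hX1 : ∑ v, ∑ j, X v j = 1) (hXα : ∀ v, ∑ j, X v j = α v) (hXμ : ∀ j, ∑ v, X v j = μ j)
    {δ : ℝ} (hδ : ∑ v, ∑ j, (if P v = Q j then 0 else X v j) ≤ δ) {C : ℝ} (hC : 0 ≤ C)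
    {g : ι → ι → ℝ} (hg : ∀ c d, |g c d| ≤ C) {β : V → V → ℝ} {γ : J → J → ℝ} {ε₁ ε₂ : ℝ}
    (h₁ : CutBound α (fun v w => β v w - g (P v) (P w)) ε₁)
    (h₂ : CutBound μ (fun i j => γ i j - g (Q i) (Q j)) ε₂) :
    CutBound (fun p : V × J => X p.1 p.2) (fun p q => β p.1 q.1 - γ p.2 q.2)
      (ε₁ + 4 * C * δ + ε₂) := by
  classical
  intro a b ha hb
  have hfst {s : V × J → ℝ} (hs : ∀ p, |s p| ≤ X p.1 p.2) (v : V) :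
      ∑ p with p.1 = v, |s p| ≤ α v := by
    refine (Finset.sum_le_sum fun p _ => hs p).trans_eq ?_
    rw [Finset.sum_filter, Fintype.sum_prod_type, ← hXα]
    simp [Finset.sum_ite_irrel]
  have hsnd {s : V × J → ℝ} (hs : ∀ p, |s p| ≤ X p.1 p.2) (j : J) :
      ∑ p with p.2 = j, |s p| ≤ μ j := by
    refine (Finset.sum_le_sum fun p _ => hs p).trans_eq ?_
    rw [Finset.sum_filter, Fintype.sum_prod_type, ← hXμ]
    simp
  have e1 := h₁.abs_sum_comp_le Prod.fst (hfst ha) (hfst hb)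
  have e2 := h₂.abs_sum_comp_le Prod.snd (hsnd ha) (hsnd hb)
  let χ : V × J → ℝ := fun p => if P p.1 = Q p.2 then 0 else 1
  have hX1' : ∑ p : V × J, X p.1 p.2 = 1 := by rw [Fintype.sum_prod_type, hX1]
  have hχ : ∑ p : V × J, X p.1 p.2 * χ p ≤ δ := by
    refine le_of_eq_of_le ?_ hδ
    rw [Fintype.sum_prod_type]
    simp [χ]
  have e3 : |∑ p : V × J, ∑ q : V × J,
      a p * b q * (g (P p.1) (P q.1) - g (Q p.2) (Q q.2))| ≤ 4 * C * δ := by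
    calc _ ≤ ∑ p : V × J, ∑ q : V × J, X p.1 p.2 * X q.1 q.2 * (2 * C * (χ p + χ q)) := by
          refine (Finset.abs_sum_le_sum_abs _ _).trans (Finset.sum_le_sum fun p _ => ?_)
          refine (Finset.abs_sum_le_sum_abs _ _).trans (Finset.sum_le_sum fun q _ => ?_)
          have h1 := (abs_nonneg _).trans (ha p)
          have h2 := (abs_nonneg _).trans (hb q)
          rw [abs_mul, abs_mul]
          refine mul_le_mul (mul_le_mul (ha p) (hb q) (abs_nonneg _) h1) ?_ (abs_nonneg _)
            (mul_nonneg h1 h2)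
          have h3 : |g (P p.1) (P q.1) - g (Q p.2) (Q q.2)| ≤ 2 * C :=
            (abs_sub _ _).trans (by linarith [hg (P p.1) (P q.1), hg (Q p.2) (Q q.2)])
          simp only [χ]
          split_ifs with h4 h5 h5
          · simp [h4, h5]
          all_goals linarith
      _ = 2 * C * ((∑ p : V × J, X p.1 p.2 * χ p) * (∑ q : V × J, X q.1 q.2) +
            (∑ p : V × J, X p.1 p.2) * ∑ q : V × J, X q.1 q.2 * χ q) := by
          rw [Finset.sum_mul_sum, Finset.sum_mul_sum, ← Finset.sum_add_distrib, Finset.mul_sum]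
          refine Finset.sum_congr rfl fun p _ => ?_
          rw [← Finset.sum_add_distrib, Finset.mul_sum]
          exact Finset.sum_congr rfl fun q _ => by ring
      _ ≤ _ := by
          rw [hX1']
          nlinarith
  have e4 : ∑ p : V × J, ∑ q : V × J, a p * b q * (β p.1 q.1 - γ p.2 q.2) =
      ∑ p, ∑ q, a p * b q * (β p.1 q.1 - g (P p.1) (P q.1)) +
      ∑ p, ∑ q, a p * b q * (g (P p.1) (P q.1) - g (Q p.2) (Q q.2)) -
      ∑ p, ∑ q, a p * b q * (γ p.2 q.2 - g (Q p.2) (Q q.2)) := by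
    simp only [← Finset.sum_add_distrib, ← Finset.sum_sub_distrib]
    exact Finset.sum_congr rfl fun p _ => Finset.sum_congr rfl fun q _ => by ring
  rw [e4]
  exact (abs_sub _ _).trans (add_le_add ((abs_add_le _ _).trans (add_le_add e1 e3)) e2)

theorem cutDist_le_two_mul {G : WeightedGraph.{u}} {G' : WeightedGraph.{v}} {C : ℝ}
    (hG : ∀ i j, |G.edgeWeight i j| ≤ C) (hG' : ∀ i j, |G'.edgeWeight i j| ≤ C) :
    cutDist G G' ≤ 2 * C := by
  obtain ⟨X, hX⟩ := fractionalOverlays_nonempty G G'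
  have hX1 : ∑ p : G.V × G'.V, X p.1 p.2 = 1 :=
    (sum_overlay hX).trans G.totalWeight_normalize
  have hD (p q : G.V × G'.V) : |G.edgeWeight p.1 q.1 - G'.edgeWeight p.2 q.2| ≤ 2 * C :=
    (abs_sub _ _).trans (by linarith [hG p.1 q.1, hG' p.2 q.2])
  exact cutDist_le hX
    ((cutBound_of_abs_le hX1 hD).abs_sum_finset_le fun p => hX.1 p.1 p.2)

/-! ### Colour frequencies in a random sample -/

/-- The variance of the empirical mean of `k` independent samples of a centred function. -/
theorem sum_pi_sq_mean_le {V : Type*} [Fintype V] {α h : V → ℝ} (hα0 : ∀ v, 0 ≤ α v)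
    (hα1 : ∑ v, α v = 1) (hh : ∀ v, |h v| ≤ 1) (hmean : ∑ v, α v * h v = 0) {k : ℕ} (hk : 0 < k) :
    ∑ x : Fin k → V, (∏ i, α (x i)) * (∑ i, 1 / (k : ℝ) * h (x i)) ^ 2 ≤ 1 / k := by
  have hk' : (0 : ℝ) < k := by exact_mod_cast hk
  have hp (x : Fin k → V) : 0 ≤ ∏ i, α (x i) := Finset.prod_nonneg fun i _ => hα0 _
  have key (i j : Fin k) : ∑ x : Fin k → V, (∏ i, α (x i)) * (h (x i) * h (x j)) ≤
      if i = j then 1 else 0 := by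
    split_ifs with hij
    · rw [← sum_prod_pi_eq_one (I := Fin k) (p := fun _ => α) fun _ => hα1]
      refine Finset.sum_le_sum fun x _ => mul_le_of_le_one_right (hp x) ?_
      have := mul_le_one₀ (hh (x i)) (abs_nonneg _) (hh (x j))
      rw [← abs_mul] at this
      exact (le_abs_self _).trans this
    · rw [sum_pi_resample (p := fun _ : Fin k => α) (fun _ => hα1) i]
      refine (Finset.sum_eq_zero fun x _ => ?_).le
      simp only [Function.update_self, Function.update_of_ne (Ne.symm hij)]
      simp only [← mul_assoc, ← Finset.sum_mul, hmean, zero_mul, mul_zero]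
  calc _ = ∑ i, ∑ j, 1 / (k : ℝ) ^ 2 *
        ∑ x : Fin k → V, (∏ i, α (x i)) * (h (x i) * h (x j)) := by
        have e (x : Fin k → V) : (∏ i, α (x i)) * (∑ i, 1 / (k : ℝ) * h (x i)) ^ 2 =
            ∑ i, ∑ j, 1 / (k : ℝ) ^ 2 * ((∏ i, α (x i)) * (h (x i) * h (x j))) := by
          rw [sq, Finset.sum_mul_sum, Finset.mul_sum]
          refine Finset.sum_congr rfl fun i _ => ?_
          rw [Finset.mul_sum]
          exact Finset.sum_congr rfl fun j _ => by ring
        simp only [e, Finset.mul_sum]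
        rw [Finset.sum_comm]
        exact Finset.sum_congr rfl fun i _ => Finset.sum_comm
    _ ≤ ∑ i : Fin k, ∑ j : Fin k, 1 / (k : ℝ) ^ 2 * if i = j then 1 else 0 :=
        Finset.sum_le_sum fun i _ => Finset.sum_le_sum fun j _ =>
          mul_le_mul_of_nonneg_left (key i j) (by positivity)
    _ = 1 / k := by
        simp only [← Finset.mul_sum, Finset.sum_ite_eq, Finset.mem_univ, if_true, Finset.sum_const,
          Finset.card_univ, Fintype.card_fin, nsmul_eq_mul, mul_one]
        field_simp

/-- The colour frequencies of a large sample are close to the colour distribution. -/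
theorem sum_pi_frequency_le {V ι : Type*} [Fintype V] [Fintype ι] [DecidableEq ι] {α : V → ℝ}
    (hα0 : ∀ v, 0 ≤ α v) (hα1 : ∑ v, α v = 1) (P : V → ι) {ζ : ℝ} (hζ : 0 < ζ)
    {k : ℕ} (hk : 0 < k) :
    ∑ x : Fin k → V, (∏ i, α (x i)) *
        ∑ c, |∑ v with P v = c, α v - ∑ i with P (x i) = c, 1 / (k : ℝ)| ≤
      Fintype.card ι * (ζ + 1 / k / ζ) := by
  have hk' : (0 : ℝ) < k := by exact_mod_cast hk
  have hp (x : Fin k → V) : 0 ≤ ∏ i, α (x i) := Finset.prod_nonneg fun i _ => hα0 _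
  have key (c : ι) : ∑ x : Fin k → V, (∏ i, α (x i)) *
      |∑ v with P v = c, α v - ∑ i with P (x i) = c, 1 / (k : ℝ)| ≤ ζ + 1 / k / ζ := by
    set a := ∑ v with P v = c, α v with ha
    have ha0 : 0 ≤ a := Finset.sum_nonneg fun v _ => hα0 v
    have ha1 : a ≤ 1 :=
      hα1 ▸ Finset.sum_le_sum_of_subset_of_nonneg (Finset.subset_univ _) fun v _ _ => hα0 v
    let h : V → ℝ := fun v => a - if P v = c then 1 else 0
    have hvar := sum_pi_sq_mean_le (h := h) hα0 hα1 (fun v => by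
        simp only [h]
        split_ifs <;> rw [abs_le] <;> constructor <;> linarith) (by
        simp only [h, mul_sub, Finset.sum_sub_distrib, ← Finset.sum_mul, hα1, mul_ite, mul_one,
          mul_zero, ← Finset.sum_filter]
        rw [← ha]
        ring) hk
    have e (x : Fin k → V) : ∑ i, 1 / (k : ℝ) * h (x i) =
        a - ∑ i with P (x i) = c, 1 / (k : ℝ) := by
      simp only [h, mul_sub, Finset.sum_sub_distrib, mul_ite, mul_one, mul_zero,
        ← Finset.sum_filter]
      simp only [Finset.sum_const, Finset.card_univ, Fintype.card_fin, nsmul_eq_mul]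
      field_simp
    simp only [e] at hvar
    calc _ ≤ ∑ x : Fin k → V, (∏ i, α (x i)) *
          (ζ + (a - ∑ i with P (x i) = c, 1 / (k : ℝ)) ^ 2 / ζ) := by
          refine Finset.sum_le_sum fun x _ => mul_le_mul_of_nonneg_left ?_ (hp x)
          generalize a - ∑ i with P (x i) = c, 1 / (k : ℝ) = y
          have : ζ * |y| ≤ ζ * (ζ + y ^ 2 / ζ) := by
            rw [mul_add, mul_div_cancel₀ _ hζ.ne', ← sq_abs y]
            nlinarith [sq_nonneg (ζ - |y|), sq_nonneg |y|, sq_nonneg ζ]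
          exact le_of_mul_le_mul_left this hζ
      _ = ζ * (∑ x : Fin k → V, ∏ i, α (x i)) + (∑ x : Fin k → V, (∏ i, α (x i)) *
            (a - ∑ i with P (x i) = c, 1 / (k : ℝ)) ^ 2) / ζ := by
          rw [Finset.mul_sum, Finset.sum_div, ← Finset.sum_add_distrib]
          exact Finset.sum_congr rfl fun x _ => by ring
      _ ≤ _ := by
          rw [sum_prod_pi_eq_one (I := Fin k) (p := fun _ => α) fun _ => hα1, mul_one]
          have := div_le_div_of_nonneg_right hvar hζ.le
          linarith
  calc _ = ∑ c, ∑ x : Fin k → V, (∏ i, α (x i)) *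
      |∑ v with P v = c, α v - ∑ i with P (x i) = c, 1 / (k : ℝ)| := by
        simp only [Finset.mul_sum]
        exact Finset.sum_comm
    _ ≤ ∑ _c : ι, (ζ + 1 / k / ζ) := Finset.sum_le_sum fun c _ => key c
    _ = _ := by rw [Finset.sum_const, Finset.card_univ, nsmul_eq_mul]

theorem sum_pi_prod_injective {I J V : Type*} [Fintype I] [DecidableEq I] [Fintype J]
    [DecidableEq J] [Fintype V] {p : I → V → ℝ} (hp : ∀ i, ∑ v, p i v = 1) {e : J → I}
    (he : Function.Injective e) (f : J → V → ℝ) :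
    ∑ x : I → V, (∏ i, p i (x i)) * ∏ j, f j (x (e j)) = ∏ j, ∑ v, p (e j) v * f j v := by
  rw [Fintype.prod_sum]
  simp only [Finset.prod_mul_distrib]
  exact sum_pi_comp_injective hp he fun y => ∏ j, f j (y j)

/-! ### Random signed graphs -/

/-- The real sign encoded by a Boolean. -/
def boolSign (s : Bool) : ℝ := if s then 1 else -1

/-- The random signing of the pairs of nodes with prescribed independent means: the probability of
the signs `σ` when the sign of `e` has mean `b e`. -/
def signProb {I : Type*} [Fintype I] (b : I → ℝ) (σ : I → Bool) : ℝ :=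
  ∏ e, (1 + boolSign (σ e) * b e) / 2

/-- The means of the signs on the pairs of sampled nodes `x`: the edgeweights of `G`, scaled to
`[-1, 1]`. Pairs `{i, i}` get mean zero, since homomorphism densities of simple graphs carry no
information about loops. -/
def sampleMean (G : WeightedGraph.{u}) (C : ℝ) {k : ℕ} (x : Fin k → G.V) (e : Sym2 (Fin k)) : ℝ :=
  if e.IsDiag then 0 else G.pairWeight (e.map x) / C

/-- The graph on `k` nodes of equal weight whose edgeweights are `± C`, with the signs `σ`. -/
def signGraph (k : ℕ) [NeZero k] (C : ℝ) (σ : Sym2 (Fin k) → Bool) : WeightedGraph.{0} where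
  V := Fin k
  nodeWeight _ := 1
  edgeWeight i j := C * boolSign (σ s(i, j))
  nodeWeight_pos _ := one_pos
  edgeWeight_symm i j := by rw [Sym2.eq_swap]

/-- The probability that the random `± C` graph obtained from `k` random nodes of `G` is
`signGraph k C σ`. -/
def sampleProb (G : WeightedGraph.{u}) (C : ℝ) (k : ℕ) (σ : Sym2 (Fin k) → Bool) : ℝ :=
  ∑ x : Fin k → G.V, (∏ i, G.normalize.nodeWeight (x i)) * signProb (sampleMean G C x) σ

theorem abs_boolSign (s : Bool) : |boolSign s| = 1 := by
  cases s <;> simp [boolSign]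

theorem signProb_nonneg {I : Type*} [Fintype I] {b : I → ℝ} (hb : ∀ e, |b e| ≤ 1) (σ : I → Bool) :
    0 ≤ signProb b σ := by
  refine Finset.prod_nonneg fun e _ => ?_
  have h : |boolSign (σ e) * b e| ≤ 1 := by rw [abs_mul, abs_boolSign, one_mul]; exact hb e
  linarith [(abs_le.1 h).1]

theorem sum_boolSign_marginal (b : ℝ) : ∑ s, (1 + boolSign s * b) / 2 = 1 := by
  simp [boolSign]
  ring

theorem sum_signProb {I : Type*} [Fintype I] [DecidableEq I] (b : I → ℝ) :
    ∑ σ : I → Bool, signProb b σ = 1 :=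
  sum_prod_pi_eq_one (p := fun e s => (1 + boolSign s * b e) / 2)
    fun e => sum_boolSign_marginal (b e)

theorem sum_signProb_mul_prod {I J : Type*} [Fintype I] [DecidableEq I] [Fintype J]
    [DecidableEq J] (b : I → ℝ) {e : J → I} (he : Function.Injective e) (C : ℝ) (f : J → ℝ) :
    ∑ σ : I → Bool, signProb b σ * ∏ j, (C * boolSign (σ (e j)) - f j) =
      ∏ j, (C * b (e j) - f j) := by
  refine (sum_pi_prod_injective (p := fun e s => (1 + boolSign s * b e) / 2)
    (fun e => sum_boolSign_marginal (b e)) he fun j s => C * boolSign s - f j).trans ?_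
  refine Finset.prod_congr rfl fun j _ => ?_
  simp [boolSign]
  ring

theorem abs_sampleMean_le {G : WeightedGraph.{u}} {C : ℝ} (hC : 0 < C)
    (hG : ∀ i j, |G.edgeWeight i j| ≤ C) {k : ℕ} (x : Fin k → G.V) (e : Sym2 (Fin k)) :
    |sampleMean G C x e| ≤ 1 := by
  unfold sampleMean
  split_ifs
  · simp
  · induction e with | _ i j
    simpa [abs_div, abs_of_pos hC, div_le_one hC, pairWeight_mk] using hG (x i) (x j)

theorem sampleProb_nonneg {G : WeightedGraph.{u}} {C : ℝ} (hC : 0 < C)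
    (hG : ∀ i j, |G.edgeWeight i j| ≤ C) {k : ℕ} (σ : Sym2 (Fin k) → Bool) :
    0 ≤ sampleProb G C k σ :=
  Finset.sum_nonneg fun x _ => mul_nonneg
    (Finset.prod_nonneg fun _ _ => (G.normalize.nodeWeight_pos _).le)
    (signProb_nonneg (abs_sampleMean_le hC hG x) σ)

theorem sum_sampleProb_mul (G : WeightedGraph.{u}) (C : ℝ) (k : ℕ)
    (f : (Sym2 (Fin k) → Bool) → ℝ) :
    ∑ σ, sampleProb G C k σ * f σ = ∑ x : Fin k → G.V, (∏ i, G.normalize.nodeWeight (x i)) *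
      ∑ σ, signProb (sampleMean G C x) σ * f σ := by
  simp only [sampleProb, Finset.sum_mul, Finset.mul_sum]
  rw [Finset.sum_comm]
  exact Finset.sum_congr rfl fun x _ => Finset.sum_congr rfl fun σ _ => by ring

theorem sum_normalize_nodeWeight (G : WeightedGraph.{u}) :
    ∑ i : G.V, G.normalize.nodeWeight i = 1 := G.totalWeight_normalize

theorem sum_sampleProb (G : WeightedGraph.{u}) (C : ℝ) (k : ℕ) :
    ∑ σ, sampleProb G C k σ = 1 := by
  classical
  have := sum_sampleProb_mul G C k fun _ => 1
  simp only [mul_one] at this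
  rw [this]
  simp only [sum_signProb, mul_one]
  exact sum_prod_pi_eq_one (I := Fin k) (p := fun _ => G.normalize.nodeWeight)
    fun _ => G.sum_normalize_nodeWeight

/-- A four-cycle on distinct sampled nodes has small expected weight in the difference between a
random `± C` graph and the sampled step kernel, if the step kernel is close in cut norm. -/
theorem sum_sample_cycle_le {G : WeightedGraph.{u}} {C : ℝ} (hC : 0 < C)
    (hG : ∀ i j, |G.edgeWeight i j| ≤ C) {f : G.V → G.V → ℝ} (hf : ∀ v w, |f v w| ≤ C) {ε : ℝ}
    (hcut : CutBound G.normalize.nodeWeight (fun v w => G.edgeWeight v w - f v w) ε)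
    {k : ℕ} {i l j m : Fin k} (hil : i ≠ l) (hij : i ≠ j) (him : i ≠ m) (hlj : l ≠ j)
    (hlm : l ≠ m) (hjm : j ≠ m) :
    ∑ x : Fin k → G.V, (∏ i, G.normalize.nodeWeight (x i)) *
      ∑ σ, signProb (sampleMean G C x) σ *
        ((C * boolSign (σ s(i, j)) - f (x i) (x j)) * (C * boolSign (σ s(i, m)) - f (x i) (x m)) *
        ((C * boolSign (σ s(l, j)) - f (x l) (x j)) * (C * boolSign (σ s(l, m)) - f (x l) (x m))))
      ≤ (2 * C) ^ 3 * ε := by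
  classical
  let α : G.V → ℝ := G.normalize.nodeWeight
  have hα0 (v : G.V) : 0 ≤ α v := (G.normalize.nodeWeight_pos v).le
  have hα1 : ∑ v, α v = 1 := G.sum_normalize_nodeWeight
  let D : G.V → G.V → ℝ := fun v w => G.edgeWeight v w - f v w
  have hD (v w) : |D v w / (2 * C)| ≤ 1 := by
    rw [abs_div, abs_of_pos (by positivity : 0 < 2 * C), div_le_one (by positivity)]
    exact (abs_sub _ _).trans (by linarith [hG v w, hf v w])
  have hinj : Function.Injective ![s(i, j), s(i, m), s(l, j), s(l, m)] := by
    intro a b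
    fin_cases a <;> fin_cases b <;>
      simp [hil, hil.symm, hij, hij.symm, him, him.symm, hlj, hlj.symm, hlm, hlm.symm, hjm,
        hjm.symm]
  have hσ (x : Fin k → G.V) : ∑ σ, signProb (sampleMean G C x) σ *
        ((C * boolSign (σ s(i, j)) - f (x i) (x j)) * (C * boolSign (σ s(i, m)) - f (x i) (x m)) *
        ((C * boolSign (σ s(l, j)) - f (x l) (x j)) * (C * boolSign (σ s(l, m)) - f (x l) (x m)))) =
      D (x i) (x j) * D (x i) (x m) * (D (x l) (x j) * D (x l) (x m)) := by
    have h := sum_signProb_mul_prod (sampleMean G C x) hinj C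
      ![f (x i) (x j), f (x i) (x m), f (x l) (x j), f (x l) (x m)]
    have hb {a b : Fin k} (hab : a ≠ b) :
        C * sampleMean G C x s(a, b) = G.edgeWeight (x a) (x b) := by
      rw [sampleMean, if_neg (by simpa using hab), Sym2.map_mk, pairWeight_mk]
      field_simp
    simp only [Fin.prod_univ_four, Matrix.cons_val, hb hij, hb him, hb hlj, hb hlm] at h
    simp only [D, ← mul_assoc] at h ⊢
    exact h
  simp only [hσ]
  have hsum : ∑ x : Fin k → G.V, (∏ i, α (x i)) *
        (D (x i) (x j) * D (x i) (x m) * (D (x l) (x j) * D (x l) (x m))) =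
      (2 * C) ^ 3 * ∑ x : Fin k → G.V, (∏ i, α (x i)) * (D (x i) (x j) * (D (x i) (x m) / (2 * C)) *
        (D (x l) (x j) / (2 * C) * (D (x l) (x m) / (2 * C)))) := by
    rw [Finset.mul_sum]
    refine Finset.sum_congr rfl fun x _ => ?_
    field_simp
  refine hsum.trans_le (mul_le_mul_of_nonneg_left ((le_abs_self _).trans ?_) (by positivity))
  refine hcut.abs_sum_pi_le hα0 hα1 i j (s := fun x v => D v (x m) / (2 * C))
    (t := fun x w => D (x l) w / (2 * C) * (D (x l) (x m) / (2 * C))) (fun x v => hD _ _)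
    (fun x w => ?_) fun x v w => ?_
  · rw [abs_mul]
    exact mul_le_one₀ (hD _ _) (abs_nonneg _) (hD _ _)
  · simp only [Function.update_self, Function.update_of_ne hij, Function.update_of_ne hjm.symm,
      Function.update_of_ne him.symm, Function.update_of_ne hil.symm, Function.update_of_ne hlj, D]
    ring

/-! ### The sampling theorem -/

theorem cycleDensity_uniform (k : ℕ) (U : Fin k → Fin k → ℝ) :
    cycleDensity (fun _ => 1 / (k : ℝ)) U =
      ∑ j, ∑ m, ∑ i, ∑ l, (1 / (k : ℝ)) ^ 4 * (U i j * U i m * (U l j * U l m)) := by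
  refine Finset.sum_congr rfl fun j _ => Finset.sum_congr rfl fun m _ => ?_
  rw [sq, Finset.sum_mul_sum, Finset.mul_sum]
  refine Finset.sum_congr rfl fun i _ => ?_
  rw [Finset.mul_sum]
  exact Finset.sum_congr rfl fun l _ => by ring

/-- The expected four-cycle density of the difference between the random `± C` graph and the
sampled step kernel. The term `1 / k` accounts for degenerate four-cycles. -/
theorem sum_sample_cycleDensity_le {G : WeightedGraph.{u}} {C : ℝ} (hC : 0 < C)
    (hG : ∀ i j, |G.edgeWeight i j| ≤ C) {f : G.V → G.V → ℝ} (hf : ∀ v w, |f v w| ≤ C) {ε : ℝ}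
    (hε : 0 ≤ ε) (hcut : CutBound G.normalize.nodeWeight (fun v w => G.edgeWeight v w - f v w) ε)
    {k : ℕ} (hk : 0 < k) :
    ∑ x : Fin k → G.V, (∏ i, G.normalize.nodeWeight (x i)) *
      ∑ σ, signProb (sampleMean G C x) σ *
        cycleDensity (fun _ => 1 / (k : ℝ)) (fun i j => C * boolSign (σ s(i, j)) - f (x i) (x j))
      ≤ (2 * C) ^ 3 * ε + 6 * (2 * C) ^ 4 / k := by
  classical
  have hk' : (0 : ℝ) < k := by exact_mod_cast hk
  let U (x : Fin k → G.V) (σ : Sym2 (Fin k) → Bool) (i j : Fin k) : ℝ :=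
    C * boolSign (σ s(i, j)) - f (x i) (x j)
  have hU (x σ i j) : |U x σ i j| ≤ 2 * C := by
    refine (abs_sub _ _).trans ?_
    rw [abs_mul, abs_boolSign, abs_of_pos hC]
    linarith [hf (x i) (x j)]
  have hα0 (x : Fin k → G.V) : 0 ≤ ∏ i, G.normalize.nodeWeight (x i) :=
    Finset.prod_nonneg fun _ _ => (G.normalize.nodeWeight_pos _).le
  let T (i l j m : Fin k) : ℝ := ∑ x : Fin k → G.V, (∏ i, G.normalize.nodeWeight (x i)) *
    ∑ σ, signProb (sampleMean G C x) σ * (U x σ i j * U x σ i m * (U x σ l j * U x σ l m))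
  have hTle (i l j m) : T i l j m ≤ (2 * C) ^ 4 := by
    calc T i l j m ≤ ∑ x : Fin k → G.V, (∏ i, G.normalize.nodeWeight (x i)) *
          ∑ σ, signProb (sampleMean G C x) σ * (2 * C) ^ 4 := by
          refine Finset.sum_le_sum fun x _ => mul_le_mul_of_nonneg_left ?_ (hα0 x)
          refine Finset.sum_le_sum fun σ _ => mul_le_mul_of_nonneg_left ?_
            (signProb_nonneg (abs_sampleMean_le hC hG x) σ)
          refine (le_abs_self _).trans ?_
          rw [abs_mul, abs_mul, abs_mul]
          calc _ ≤ (2 * C) * (2 * C) * ((2 * C) * (2 * C)) := by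
                gcongr <;> exact hU _ _ _ _
            _ = _ := by ring
      _ = (2 * C) ^ 4 := by
          simp only [← Finset.sum_mul, sum_signProb, one_mul]
          have h1 : ∑ x : Fin k → G.V, ∏ i, G.normalize.nodeWeight (x i) = 1 :=
            sum_prod_pi_eq_one (I := Fin k) (p := fun _ (v : G.V) => G.normalize.nodeWeight v)
              fun _ => G.sum_normalize_nodeWeight
          rw [h1, one_mul]
  let χ (i j : Fin k) : ℝ := if i = j then 1 else 0
  have hχ0 (i j) : 0 ≤ χ i j := by
    simp only [χ]
    split_ifs <;> norm_num
  have hT (i l j m) : T i l j m ≤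
      (2 * C) ^ 3 * ε + (2 * C) ^ 4 * (χ i l + χ i j + χ i m + χ l j + χ l m + χ j m) := by
    have hM : 0 ≤ (2 * C) ^ 4 := by positivity
    have hκ : 0 ≤ (2 * C) ^ 3 * ε := by positivity
    by_cases h : i ≠ l ∧ i ≠ j ∧ i ≠ m ∧ l ≠ j ∧ l ≠ m ∧ j ≠ m
    · obtain ⟨h1, h2, h3, h4, h5, h6⟩ := h
      simpa [χ, h1, h2, h3, h4, h5, h6] using sum_sample_cycle_le hC hG hf hcut h1 h2 h3 h4 h5 h6
    · have : 1 ≤ χ i l + χ i j + χ i m + χ l j + χ l m + χ j m := by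
        by_contra hlt
        refine h ⟨?_, ?_, ?_, ?_, ?_, ?_⟩
        all_goals
          intro he
          have h1 : ∀ a b : Fin k, a = b → χ a b = 1 := fun a b hab => if_pos hab
          have := h1 _ _ he
          linarith [hχ0 i l, hχ0 i j, hχ0 i m, hχ0 l j, hχ0 l m, hχ0 j m]
      nlinarith [hTle i l j m]
  have hswap : ∑ x : Fin k → G.V, (∏ i, G.normalize.nodeWeight (x i)) *
      ∑ σ, signProb (sampleMean G C x) σ * cycleDensity (fun _ => 1 / (k : ℝ)) (U x σ) =
      ∑ j, ∑ m, ∑ i, ∑ l, (1 / (k : ℝ)) ^ 4 * T i l j m := by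
    simp only [cycleDensity_uniform, T, Finset.mul_sum]
    conv_lhs =>
      enter [2, x]
      rw [Finset.sum_comm]
      enter [2, j]
      rw [Finset.sum_comm]
      enter [2, m]
      rw [Finset.sum_comm]
      enter [2, i]
      rw [Finset.sum_comm]
    rw [Finset.sum_comm]
    refine Finset.sum_congr rfl fun j _ => ?_
    rw [Finset.sum_comm]
    refine Finset.sum_congr rfl fun m _ => ?_
    rw [Finset.sum_comm]
    refine Finset.sum_congr rfl fun i _ => ?_
    rw [Finset.sum_comm]
    exact Finset.sum_congr rfl fun l _ => Finset.sum_congr rfl fun x _ =>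
      Finset.sum_congr rfl fun σ _ => by ring
  refine hswap.trans_le ?_
  calc _ ≤ ∑ j : Fin k, ∑ m : Fin k, ∑ i : Fin k, ∑ l : Fin k, (1 / (k : ℝ)) ^ 4 *
        ((2 * C) ^ 3 * ε + (2 * C) ^ 4 * (χ i l + χ i j + χ i m + χ l j + χ l m + χ j m)) :=
        Finset.sum_le_sum fun j _ => Finset.sum_le_sum fun m _ => Finset.sum_le_sum fun i _ =>
          Finset.sum_le_sum fun l _ => mul_le_mul_of_nonneg_left (hT i l j m) (by positivity)
    _ = _ := by
        simp only [← Finset.mul_sum, Finset.sum_add_distrib, χ, Finset.sum_const, Finset.card_univ,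
          Fintype.card_fin, nsmul_eq_mul, Finset.sum_ite_eq, Finset.sum_ite_eq',
          Finset.mem_univ, if_true, mul_one]
        field_simp
        ring

theorem normalize_signGraph_nodeWeight (k : ℕ) [NeZero k] (C : ℝ) (σ : Sym2 (Fin k) → Bool)
    (i : Fin k) : (signGraph k C σ).normalize.nodeWeight i = 1 / (k : ℝ) := by
  change (1 : ℝ) / (∑ _ : Fin k, (1 : ℝ)) = 1 / k
  simp

/-- The cut distance of a graph to a `± C` graph is controlled by their distances to a common step
kernel, the latter measured by four-cycles, and the difference of the colour distributions. -/
theorem cutDist_signGraph_le {G : WeightedGraph.{u}} {C : ℝ} (hC : 0 < C) {ι : Type}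
    [Fintype ι] [DecidableEq ι] {P : G.V → ι} {g : ι → ι → ℝ} (hg : ∀ c d, |g c d| ≤ C) {ε : ℝ}
    (hcut : CutBound G.normalize.nodeWeight
      (fun v w => G.edgeWeight v w - g (P v) (P w)) ε)
    {θ : ℝ} (hθ : 0 < θ) {k : ℕ} [NeZero k] (x : Fin k → G.V) (σ : Sym2 (Fin k) → Bool) :
    cutDist G (signGraph k C σ) ≤ ε +
      4 * C * ∑ c, |∑ v with P v = c, G.normalize.nodeWeight v -
        ∑ i with P (x i) = c, 1 / (k : ℝ)| +
      (θ + cycleDensity (fun _ => 1 / (k : ℝ))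
        (fun i j => C * boolSign (σ s(i, j)) - g (P (x i)) (P (x j))) / θ ^ 3) := by
  have hk' : (0 : ℝ) < k := by exact_mod_cast Nat.pos_of_ne_zero (NeZero.ne k)
  have hμ1 : ∑ _i : Fin k, 1 / (k : ℝ) = 1 := by
    simp only [Finset.sum_const, Finset.card_univ, Fintype.card_fin, nsmul_eq_mul]
    field_simp
  obtain ⟨X, hX0, hX1, hX2, hX⟩ := exists_coupling (α := fun v : G.V => G.normalize.nodeWeight v)
    (μ := fun _ : Fin k => 1 / (k : ℝ)) (fun v => (G.normalize.nodeWeight_pos v).le)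
    G.sum_normalize_nodeWeight (fun _ => by positivity) hμ1 P (fun i => P (x i))
  have hXo : (X : Matrix G.V (Fin k) ℝ) ∈
      fractionalOverlays G.normalize (signGraph k C σ).normalize :=
    ⟨hX0, hX1, fun i => (hX2 i).trans (normalize_signGraph_nodeWeight k C σ i).symm⟩
  have hXs : ∑ v, ∑ j, X v j = 1 := by
    simp only [hX1]
    exact G.sum_normalize_nodeWeight
  have h := cutBound_of_coupling hXs hX1 hX2 hX hC.le hg hcut
    (cutBound_of_cycleDensity hμ1
      (fun i j => C * boolSign (σ s(i, j)) - g (P (x i)) (P (x j))) hθ)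
  exact cutDist_le hXo (h.abs_sum_finset_le fun p => hX0 p.1 p.2)

/-- The sampling theorem: for large `k`, every graph with edgeweights bounded by `C` is close in
expectation to the random `± C` graph obtained from `k` of its nodes, uniformly in the graph. -/
theorem exists_sum_sampleProb_mul_cutDist_le {C ε : ℝ} (hC : 0 < C) (hε : 0 < ε) :
    ∃ (k : ℕ) (_ : NeZero k), ∀ G : WeightedGraph.{u}, (∀ i j, |G.edgeWeight i j| ≤ C) →
      ∑ σ, sampleProb G C k σ * cutDist G (signGraph k C σ) ≤ ε := by
  classical
  -- the parameters are chosen in the order: `θ` for four-cycles, `η` for the step approximation,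
  -- `ζ` for the colour frequencies, and finally `k`
  obtain ⟨θ, hθ, hθε⟩ : ∃ θ : ℝ, 0 < θ ∧ θ = ε / 5 := ⟨_, by positivity, rfl⟩
  let A : ℝ := 1 + (2 * C) ^ 3 / θ ^ 3
  have hA : 0 < A := by positivity
  let η : ℝ := ε / 5 / (4 * A)
  have hη : 0 < η := by positivity
  obtain ⟨ι, _, hι⟩ := exists_step_approx.{u} hC.le hη
  let K : ℝ := Fintype.card ι + 1
  have hK : 0 < K := by positivity
  let ζ : ℝ := ε / 5 / (4 * C * K)
  have hζ : 0 < ζ := by positivity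
  let B : ℝ := 4 * C * K / ζ + 6 * (2 * C) ^ 4 / θ ^ 3
  have hB : 0 < B := by positivity
  obtain ⟨k, hk⟩ := exists_nat_gt (B / (ε / 5))
  have hk0 : (0 : ℝ) < k := lt_trans (by positivity) hk
  have hkpos : 0 < k := by exact_mod_cast hk0
  have hBk : B / k ≤ ε / 5 := by
    rw [div_lt_iff₀ (by positivity)] at hk
    rw [div_le_iff₀ hk0]
    linarith
  refine ⟨k, ⟨hkpos.ne'⟩, fun G hG => ?_⟩
  have : NeZero k := ⟨hkpos.ne'⟩
  let α : G.V → ℝ := G.normalize.nodeWeight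
  have hα0 (v : G.V) : 0 ≤ α v := (G.normalize.nodeWeight_pos v).le
  have hα1 : ∑ v, α v = 1 := G.sum_normalize_nodeWeight
  obtain ⟨P, g, hg, hS⟩ := hι G.V α G.edgeWeight hα0 hα1 hG
  have hcut := CutBound.of_finset hS
  let mis (x : Fin k → G.V) : ℝ :=
    ∑ c, |∑ v with P v = c, α v - ∑ i with P (x i) = c, 1 / (k : ℝ)|
  let cyc (x : Fin k → G.V) (σ : Sym2 (Fin k) → Bool) : ℝ := cycleDensity (fun _ => 1 / (k : ℝ))
    (fun i j => C * boolSign (σ s(i, j)) - g (P (x i)) (P (x j)))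
  have hmis : ∑ x : Fin k → G.V, (∏ i, α (x i)) * mis x ≤ Fintype.card ι * (ζ + 1 / k / ζ) :=
    sum_pi_frequency_le hα0 hα1 P hζ hkpos
  have hcyc : ∑ x : Fin k → G.V, (∏ i, α (x i)) * ∑ σ, signProb (sampleMean G C x) σ * cyc x σ ≤
      (2 * C) ^ 3 * (4 * η) + 6 * (2 * C) ^ 4 / k :=
    sum_sample_cycleDensity_le hC hG (fun v w => hg (P v) (P w)) (by positivity) hcut hkpos
  rw [sum_sampleProb_mul]
  calc _ ≤ ∑ x : Fin k → G.V, (∏ i, α (x i)) * ∑ σ, signProb (sampleMean G C x) σ *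
        (4 * η + 4 * C * mis x + (θ + cyc x σ / θ ^ 3)) :=
        Finset.sum_le_sum fun x _ => mul_le_mul_of_nonneg_left
          (Finset.sum_le_sum fun σ _ => mul_le_mul_of_nonneg_left
            (cutDist_signGraph_le hC hg hcut hθ x σ)
            (signProb_nonneg (abs_sampleMean_le hC hG x) σ))
          (Finset.prod_nonneg fun _ _ => hα0 _)
    _ = ∑ x : Fin k → G.V, (∏ i, α (x i)) * (4 * η + θ + 4 * C * mis x +
          (∑ σ, signProb (sampleMean G C x) σ * cyc x σ) / θ ^ 3) := by
        refine Finset.sum_congr rfl fun x _ => congrArg _ ?_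
        calc _ = (∑ σ, signProb (sampleMean G C x) σ) * (4 * η + θ + 4 * C * mis x) +
              (∑ σ, signProb (sampleMean G C x) σ * cyc x σ) / θ ^ 3 := by
              rw [Finset.sum_mul, Finset.sum_div, ← Finset.sum_add_distrib]
              exact Finset.sum_congr rfl fun σ _ => by ring
          _ = _ := by rw [sum_signProb, one_mul]
    _ = (∑ x : Fin k → G.V, ∏ i, α (x i)) * (4 * η + θ) +
          4 * C * (∑ x : Fin k → G.V, (∏ i, α (x i)) * mis x) +
          (∑ x : Fin k → G.V, (∏ i, α (x i)) *
            ∑ σ, signProb (sampleMean G C x) σ * cyc x σ) / θ ^ 3 := by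
        rw [Finset.sum_mul, Finset.mul_sum, Finset.sum_div, ← Finset.sum_add_distrib,
          ← Finset.sum_add_distrib]
        exact Finset.sum_congr rfl fun x _ => by ring
    _ ≤ 4 * η + θ + 4 * C * (K * (ζ + 1 / k / ζ)) +
          ((2 * C) ^ 3 * (4 * η) + 6 * (2 * C) ^ 4 / k) / θ ^ 3 := by
        rw [sum_prod_pi_eq_one (I := Fin k) (p := fun _ => α) fun _ => hα1, one_mul]
        have hmis' : ∑ x : Fin k → G.V, (∏ i, α (x i)) * mis x ≤ K * (ζ + 1 / k / ζ) :=
          hmis.trans (mul_le_mul_of_nonneg_right (by simp [K]) (by positivity))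
        gcongr
    _ = θ + 4 * A * η + 4 * C * K * ζ + B / k := by
        simp only [A, B]
        field_simp
        ring
    _ ≤ ε := by
        have h1 : 4 * A * η = ε / 5 := by simp only [η]; field_simp
        have h2 : 4 * C * K * ζ = ε / 5 := by simp only [ζ]; field_simp
        rw [h1, h2]
        linarith

/-! ### From left-convergence to the cut distance -/

/-- Left-convergence makes the distributions of the sampled `± C` graphs converge, since their
probabilities are polynomials in homomorphism densities. -/
theorem IsLeftConvergent.exists_tendsto_sampleProb {G : ℕ → WeightedGraph.{u}}
    (h : IsLeftConvergent G) (C : ℝ) (k : ℕ) (σ : Sym2 (Fin k) → Bool) :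
    ∃ l : ℝ, Tendsto (fun n => sampleProb (G n) C k σ) atTop (𝓝 l) := by
  classical
  have hterm (r : Finset (Sym2 (Fin k))) : ∃ l : ℝ, Tendsto (fun n =>
      ∑ x : Fin k → (G n).V, (∏ i, (G n).normalize.nodeWeight (x i)) *
        ∏ e ∈ r, sampleMean (G n) C x e) atTop (𝓝 l) := by
    by_cases hr : ∃ e ∈ r, e.IsDiag
    · obtain ⟨e, he, hd⟩ := hr
      refine ⟨0, tendsto_const_nhds.congr fun n => (Finset.sum_eq_zero fun x _ => ?_).symm⟩
      rw [Finset.prod_eq_zero he (by rw [sampleMean, if_pos hd]), mul_zero]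
    · push Not at hr
      obtain ⟨l, hl⟩ := h (Fin k) (SimpleGraph.fromEdgeSet (r : Set (Sym2 (Fin k))))
      refine ⟨l / C ^ r.card, (hl.div_const _).congr fun n => ?_⟩
      have hE (_ : Fintype (SimpleGraph.fromEdgeSet (r : Set (Sym2 (Fin k)))).edgeSet) :
          (SimpleGraph.fromEdgeSet (r : Set (Sym2 (Fin k)))).edgeFinset = r := by
        ext e
        simpa using fun he => hr e he
      rw [homDensity_eq, hE, Finset.sum_div]
      refine Finset.sum_congr rfl fun x _ => ?_
      rw [mul_div_assoc, ← Finset.prod_const, ← Finset.prod_div_distrib]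
      congr 1
      exact Finset.prod_congr rfl fun e he => by rw [sampleMean, if_neg (hr e he)]
  choose L hL using hterm
  refine ⟨∑ r ∈ (Finset.univ : Finset (Sym2 (Fin k))).powerset,
    ((1 / 2) ^ Fintype.card (Sym2 (Fin k)) * ∏ e ∈ r, boolSign (σ e)) * L r,
    (tendsto_finsetSum _ fun r _ => (hL r).const_mul
      ((1 / 2) ^ Fintype.card (Sym2 (Fin k)) * ∏ e ∈ r, boolSign (σ e))).congr fun n => ?_⟩
  have hexp (x : Fin k → (G n).V) : signProb (sampleMean (G n) C x) σ =
      ∑ r ∈ (Finset.univ : Finset (Sym2 (Fin k))).powerset,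
        ((1 / 2) ^ Fintype.card (Sym2 (Fin k)) * ∏ e ∈ r, boolSign (σ e)) *
          ∏ e ∈ r, sampleMean (G n) C x e := by
    rw [signProb, Finset.prod_div_distrib, Finset.prod_const, Finset.prod_one_add,
      Finset.card_univ, Finset.sum_div]
    refine Finset.sum_congr rfl fun r _ => ?_
    rw [Finset.prod_mul_distrib, one_div, inv_pow]
    ring
  simp only [sampleProb, hexp, Finset.mul_sum]
  rw [Finset.sum_comm]
  exact Finset.sum_congr rfl fun x _ => Finset.sum_congr rfl fun r _ => by ring

theorem IsLeftConvergent.isCutCauchy {G : ℕ → WeightedGraph.{u}} (hG : HasBoundedEdgeWeights G)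
    (h : IsLeftConvergent G) : IsCutCauchy G := by
  obtain ⟨C₀, hC₀⟩ := hG
  obtain ⟨C, hC, hGC⟩ : ∃ C : ℝ, 0 < C ∧ ∀ n i j, |(G n).edgeWeight i j| ≤ C :=
    ⟨max C₀ 1, by positivity, fun n i j => (hC₀ n i j).trans (le_max_left _ _)⟩
  intro ε hε
  obtain ⟨k, _, hk⟩ := exists_sum_sampleProb_mul_cutDist_le.{u} hC (by positivity : 0 < ε / 16)
  choose l hl using fun σ => h.exists_tendsto_sampleProb C k σ
  have hlim : Tendsto (fun n => ∑ σ, |sampleProb (G n) C k σ - l σ|) atTop (𝓝 0) := by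
    have := tendsto_finsetSum Finset.univ fun σ (_ : σ ∈ Finset.univ) =>
      ((hl σ).sub_const (l σ)).abs
    simpa using this
  obtain ⟨N, hN⟩ := eventually_atTop.1 (hlim.eventually_lt_const
    (by positivity : 0 < ε / (32 * C)))
  refine ⟨N, fun m hm n hn => ?_⟩
  let p (n : ℕ) (σ : Sym2 (Fin k) → Bool) : ℝ := sampleProb (G n) C k σ
  let d (n : ℕ) (σ : Sym2 (Fin k) → Bool) : ℝ := cutDist (G n) (signGraph k C σ)
  have hp0 (n σ) : 0 ≤ p n σ := sampleProb_nonneg hC (hGC n) σ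
  have hd0 (n σ) : 0 ≤ d n σ := cutDist_nonneg _ _
  have hd (n σ) : d n σ ≤ 2 * C := by
    refine cutDist_le_two_mul (hGC n) fun i j => ?_
    change |C * boolSign (σ s(i, j))| ≤ C
    rw [abs_mul, abs_boolSign, abs_of_pos hC, mul_one]
  have hpn : ∑ σ, p n σ * d n σ ≤ ε / 16 := hk (G n) (hGC n)
  have hpm : ∑ σ, p m σ * d m σ ≤ ε / 16 := hk (G m) (hGC m)
  have hdiff : ∑ σ, |p n σ - p m σ| < ε / (16 * C) := by
    calc _ ≤ ∑ σ, (|p n σ - l σ| + |p m σ - l σ|) :=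
          Finset.sum_le_sum fun σ _ => by
            rw [abs_sub_comm (p m σ)]
            exact abs_sub_le _ _ _
      _ < ε / (32 * C) + ε / (32 * C) := by
          rw [Finset.sum_add_distrib]
          exact add_lt_add (hN n hn) (hN m hm)
      _ = _ := by field_simp; ring
  -- average the triangle inequality over a random graph sampled from `G n`, which has nearly the
  -- same distribution as one sampled from `G m`
  calc cutDist (G m) (G n) = ∑ σ, p n σ * cutDist (G m) (G n) := by
        rw [← Finset.sum_mul, show ∑ σ, p n σ = 1 from sum_sampleProb _ _ _, one_mul]
    _ ≤ ∑ σ, 4 * (p m σ * d m σ + p n σ * d n σ + |p n σ - p m σ| * (2 * C)) := by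
        refine Finset.sum_le_sum fun σ _ => ?_
        have h1 := mul_le_mul_of_nonneg_left
          (cutDist_le_of_common (G m) (G n) (signGraph k C σ)) (hp0 n σ)
        have h2 : (p n σ - p m σ) * d m σ ≤ |p n σ - p m σ| * (2 * C) :=
          mul_le_mul (le_abs_self _) (hd m σ) (hd0 m σ) (abs_nonneg _)
        change p n σ * _ ≤ p n σ * (4 * (d m σ + d n σ)) at h1
        linarith
    _ = 4 * (∑ σ, p m σ * d m σ + ∑ σ, p n σ * d n σ +
          (∑ σ, |p n σ - p m σ|) * (2 * C)) := by
        rw [← Finset.mul_sum, Finset.sum_add_distrib, Finset.sum_add_distrib, Finset.sum_mul]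
    _ < ε := by
        rw [lt_div_iff₀ (by positivity)] at hdiff
        linarith

end WeightedGraph

end

theorem theorem2p5 (G : ℕ → WeightedGraph.{u}) (hG : WeightedGraph.HasBoundedEdgeWeights G) :
    WeightedGraph.IsLeftConvergent G ↔ WeightedGraph.IsCutCauchy G :=
  ⟨WeightedGraph.IsLeftConvergent.isCutCauchy hG, WeightedGraph.IsCutCauchy.isLeftConvergent hG⟩
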